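/- All graphs are finite, simple and undirected. For a connected graph $G$, $d_G$ denotes the distance, $d_G(v)$ the degree of $v$, and for a vertex $u$ and an edge $e=xy$ put $d_G(u,e)=\min\{d_G(u,x),d_G(u,y)\}$. A set $S\subseteq V(G)$ is an edge metric generator if for any two distinct edges $e,f$ some $v\in S$ has $d_G(v,e)\ne d_G(v,f)$; $\mathrm{edim}(G)$ is the minimum cardinality of an edge metric generator. Let $G$ be a unicyclic graph, i.e. a connected graph with exactly one cycle $\mathcal C$, and let $\ell$ be the length of $\mathcal C$. For $v\in V(\mathcal C)$ let $T_v$ be the component of $G-E(\mathcal C)$ containing $v$. A vertex $v$ is branching if $v\in V(\mathcal C)$ and $d_G(v)\ge 4$, or $v\notin V(\mathcal C)$ and $d_G(v)\ge 3$. If $T_v$ contains no branching vertex, then it is a path, and its length is its number of edges. A thread attached to a vertex $v$ with $d_G(v)\ge3$ is a path $v_1\ldots v_k$ ($k\ge1$) with $v_1$ adjacent to $v$, $d_G(v_i)=2$ for $i<k$ and $d_G(v_k)=1$; let $\mathcal S(v)$ be the set of threads attached to $v$. A vertex $v\in V(\mathcal C)$ with $d_G(v)\ge4$ and $\mathcal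 S(v)\neq\emptyset$ is called bad. A set $S\subseteq V(G)$ is branch-resolving if for every vertex $v$ with $d_G(v)\ge 3$ at least $|\mathcal S(v)|-1$ threads in $\mathcal S(v)$ contain a vertex of $S$. Let $L(G)$ be the minimum cardinality of a branch-resolving set, and $\mathcal B(G)$ the set of branch-resolving sets of cardinality $L(G)$ all of whose elements have degree $1$. For $S\subseteq V(G)$ let $\mathcal A(S)$ be the set of $S$-active vertices, i.e. those $v\in V(\mathcal C)$ for which $T_v$ contains a vertex of $S$. Three distinct vertices $x,y,z$ of $\mathcal C$ form a geodesic triple if $d_G(x,y)+d_G(y,z)+d_G(z,x)=\ell$. A labelling of $\mathcal C$ is an enumeration $a_0,a_1,\ldots,a_{\ell-1}$ of $V(\mathcal C)$ in cyclic order (any starting vertex, either direction). If $\mathcal A(S)\ne\emptyset$, the labelling is normal with respect to $S$ if $a_0\in\mathcal A(S)$ and $\max\{i: a_i\in\mathcal A(S)\}$ is as small as possible among all labellings with $a_0\in\mathcal A(S)$. For a labelling $a_0,\ldots,a_{\ell-1}$ and $j\in[1,\lfloor\frac{\ell-1}2\rfloor]$ consider the following conditions. (i) Neither $a_0$ nor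 $a_j$ is bad. (ii) If $j<m:=\lfloor\frac{\ell-1}2\rfloor$, then $V(T_{a_k})=\{a_k\}$ for every $k\in\{\ell-(m-j),\ldots,\ell-1\}\cup\{j+1,\ldots,j+(m-j)\}$. (iii) If $j>1$ and no $T_{a_k}$ with $k\in[1,j-1]$ contains a branching vertex, then for every $k\in[1,j-1]$ the length of $T_{a_k}$ is at most $\frac{\ell-1}2-j$. (iv) If $j>1$ and for every $k\in[1,j-1]$ neither $T_{a_k}$ nor $T_{a_{k'}}$, $k'=\frac\ell2+j-k$, contains a branching vertex, then for every $k\in[1,j-1]$ with $|V(T_{a_{k'}})|>1$ the length of $T_{a_k}$ is at most $\frac\ell2-j$. With respect to this labelling write $G\in\mathcal O_e(\ell,j)$ if $\ell$ is odd, $1\le j\le\lfloor\frac{\ell-1}2\rfloor$ and (i), (ii), (iii) hold, and $G\in\mathcal E_e(\ell,j)$ if $\ell$ is even, $1\le j\le\lfloor\frac{\ell-1}2\rfloor$ and (i), (ii), (iv) hold. Theorem. Let $G$ be a unicyclic graph and $S\in\mathcal B(G)$. (1) Suppose $\mathcal A(S)=\emptyset$. If there are a labelling of $\mathcal C$ and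 a $j$ such that $G\in\mathcal O_e(\ell,j)\cup\mathcal E_e(\ell,j)$, then $\mathrm{edim}(G)=2$; otherwise $\mathrm{edim}(G)=3$. (2) Suppose $\mathcal A(S)=\{v\}$. If there are a labelling of $\mathcal C$ and a $j$ such that $a_0=v$ or $a_j=v$, and $G\in\mathcal O_e(\ell,j)\cup\mathcal E_e(\ell,j)$, then $\mathrm{edim}(G)=L(G)+1$; otherwise $\mathrm{edim}(G)=L(G)+2$. (3) Suppose $|\mathcal A(S)|\ge2$, let $\mathcal C$ be labelled normally with respect to $S$ (any normal labelling), and let $j=\max\{i:a_i\in\mathcal A(S)\}$. If there are three $S$-active vertices forming a geodesic triple or $G\in\mathcal O_e(\ell,j)\cup\mathcal E_e(\ell,j)$, then $\mathrm{edim}(G)=L(G)$; otherwise $\mathrm{edim}(G)=L(G)+1$. -/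

import Mathlib

namespace Unicyclic

variable {V : Type*}

/-- A unicyclic graph: a connected graph containing exactly one cycle
(cycles being identified when they are the same subgraph). -/
def IsUnicyclic (G : SimpleGraph V) : Prop :=
  G.Connected ∧
    ∃! C : G.Subgraph, ∃ (u : V) (p : G.Walk u u), p.IsCycle ∧ p.toSubgraph = C

/-- The vertices lying on a cycle of `G`; for unicyclic `G` this is `V(C)`. -/
def cycleVerts (G : SimpleGraph V) : Set V :=
  {v | ∃ (u : V) (p : G.Walk u u), p.IsCycle ∧ v ∈ p.support}

/-- The edges lying on a cycle of `G`; for unicyclic `G` this is `E(C)`. -/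
def cycleEdges (G : SimpleGraph V) : Set (Sym2 V) :=
  {e | ∃ (u : V) (p : G.Walk u u), p.IsCycle ∧ e ∈ p.edges}

/-- The length `ℓ` of the unique cycle. -/
noncomputable def cycleLength (G : SimpleGraph V) : ℕ := (cycleVerts G).ncard

/-- The distance from a vertex to an edge: the minimum of the distances to its two endpoints. -/
noncomputable def edgeDist (G : SimpleGraph V) (u : V) (e : Sym2 V) : ℕ :=
  Sym2.lift ⟨fun x y => min (G.dist u x) (G.dist u y), fun _ _ => min_comm _ _⟩ e

/-- Every two distinct edges have different distances to some vertex of `S`. -/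
def IsEdgeMetricGenerator (G : SimpleGraph V) (S : Finset V) : Prop :=
  ∀ e ∈ G.edgeSet, ∀ f ∈ G.edgeSet, e ≠ f → ∃ v ∈ S, edgeDist G v e ≠ edgeDist G v f

/-- The edge metric dimension. -/
noncomputable def edim (G : SimpleGraph V) : ℕ :=
  sInf {n | ∃ S : Finset V, IsEdgeMetricGenerator G S ∧ S.card = n}

/-- The vertex set of `T_v`, the component of `G - E(C)` containing `v`. -/
def treeAt (G : SimpleGraph V) (v : V) : Set V :=
  {w | (G.deleteEdges (cycleEdges G)).Reachable v w}

/-- The length of `T_v`, used only when `T_v` is a path: one less than its number of vertices. -/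
noncomputable def treeLength (G : SimpleGraph V) (v : V) : ℕ := (treeAt G v).ncard - 1

/-- `𝒜(S)`: the cycle vertices `v` for which `T_v` contains a vertex of `S`. -/
def activeVerts (G : SimpleGraph V) (S : Finset V) : Set V :=
  {v | v ∈ cycleVerts G ∧ ∃ s ∈ S, s ∈ treeAt G v}

/-- Three (distinct) cycle vertices forming a geodesic triple. -/
def IsGeodesicTriple (G : SimpleGraph V) (x y z : V) : Prop :=
  x ∈ cycleVerts G ∧ y ∈ cycleVerts G ∧ z ∈ cycleVerts G ∧
    x ≠ y ∧ y ≠ z ∧ z ≠ x ∧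
    G.dist x y + G.dist y z + G.dist z x = cycleLength G

/-- `a 0, a 1, …, a (ℓ - 1)` are the cycle vertices, in cyclic order; values of `a` at indices
`≥ ℓ` play no role. -/
def IsCycleLabelling (G : SimpleGraph V) (a : ℕ → V) : Prop :=
  Set.BijOn a (Set.Iio (cycleLength G)) (cycleVerts G) ∧
    ∀ i < cycleLength G, G.Adj (a i) (a ((i + 1) % cycleLength G))

/-- The maximum index `i ∈ [0, ℓ - 1]` such that `a i` is `S`-active. -/
noncomputable def maxActiveIndex (G : SimpleGraph V) (a : ℕ → V) (S : Finset V) : ℕ :=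
  sSup {i | i < cycleLength G ∧ a i ∈ activeVerts G S}

/-- A normal labelling with respect to `S`. -/
def IsNormalLabelling (G : SimpleGraph V) (a : ℕ → V) (S : Finset V) : Prop :=
  IsCycleLabelling G a ∧ a 0 ∈ activeVerts G S ∧
    ∀ b : ℕ → V, IsCycleLabelling G b → b 0 ∈ activeVerts G S →
      maxActiveIndex G a S ≤ maxActiveIndex G b S

section Finite

variable [Fintype V]

/-- A thread attached to the vertex `v` of degree at least `3`, as the list `v₁, …, v_k`. -/
def IsThread (G : SimpleGraph V) [DecidableRel G.Adj] (v : V) (l : List V) : Prop :=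
  3 ≤ G.degree v ∧ l.Nodup ∧ List.IsChain G.Adj (v :: l) ∧
    (∀ x ∈ l.dropLast, G.degree x = 2) ∧ ∃ w, l.getLast? = some w ∧ G.degree w = 1

/-- The set of all threads attached to `v`. -/
def threads (G : SimpleGraph V) [DecidableRel G.Adj] (v : V) : Set (List V) :=
  {l | IsThread G v l}

/-- For every vertex `v` of degree at least `3`, all but at most one of the threads attached to `v`
contain a vertex of `S`. -/
def IsBranchResolving (G : SimpleGraph V) [DecidableRel G.Adj] (S : Finset V) : Prop :=
  ∀ v, 3 ≤ G.degree v →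
    (threads G v).ncard - 1 ≤ {l | l ∈ threads G v ∧ ∃ x ∈ l, x ∈ S}.ncard

/-- `L(G)`: the minimum cardinality of a branch-resolving set. -/
noncomputable def minBranch (G : SimpleGraph V) [DecidableRel G.Adj] : ℕ :=
  sInf {n | ∃ S : Finset V, IsBranchResolving G S ∧ S.card = n}

/-- `ℬ(G)`: the minimum branch-resolving sets consisting of vertices of degree `1`. -/
def minLeafBranchSets (G : SimpleGraph V) [DecidableRel G.Adj] : Set (Finset V) :=
  {S | IsBranchResolving G S ∧ S.card = minBranch G ∧ ∀ s ∈ S, G.degree s = 1}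

/-- Branching vertices. -/
def IsBranching (G : SimpleGraph V) [DecidableRel G.Adj] (v : V) : Prop :=
  (v ∈ cycleVerts G ∧ 4 ≤ G.degree v) ∨ (v ∉ cycleVerts G ∧ 3 ≤ G.degree v)

/-- `T_v` contains no branching vertex. -/
def NoBranching (G : SimpleGraph V) [DecidableRel G.Adj] (v : V) : Prop :=
  ∀ w ∈ treeAt G v, ¬ IsBranching G w

/-- Bad vertices. -/
def IsBad (G : SimpleGraph V) [DecidableRel G.Adj] (v : V) : Prop :=
  v ∈ cycleVerts G ∧ 4 ≤ G.degree v ∧ (threads G v).Nonempty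

/-- The two conditions common to edge-odd and edge-even graphs. -/
def EdgeCommon (G : SimpleGraph V) [DecidableRel G.Adj] (a : ℕ → V) (j : ℕ) : Prop :=
  (¬ IsBad G (a 0) ∧ ¬ IsBad G (a j)) ∧
  (j < (cycleLength G - 1) / 2 →
    ∀ k ∈ Set.Icc (cycleLength G - ((cycleLength G - 1) / 2 - j)) (cycleLength G - 1) ∪
        Set.Icc (j + 1) (j + ((cycleLength G - 1) / 2 - j)),
      treeAt G (a k) = {a k})

/-- With its cycle labelled by `a`, the graph `G` is an edge-odd-`(ℓ, j)` graph. -/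
def EdgeOdd (G : SimpleGraph V) [DecidableRel G.Adj] (a : ℕ → V) (j : ℕ) : Prop :=
  Odd (cycleLength G) ∧ j ∈ Set.Icc 1 ((cycleLength G - 1) / 2) ∧ EdgeCommon G a j ∧
  (1 < j → (∀ k ∈ Set.Icc 1 (j - 1), NoBranching G (a k)) →
    ∀ k ∈ Set.Icc 1 (j - 1), treeLength G (a k) ≤ (cycleLength G - 1) / 2 - j)

/-- With its cycle labelled by `a`, the graph `G` is an edge-even-`(ℓ, j)` graph. -/
def EdgeEven (G : SimpleGraph V) [DecidableRel G.Adj] (a : ℕ → V) (j : ℕ) : Prop :=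
  Even (cycleLength G) ∧ j ∈ Set.Icc 1 ((cycleLength G - 1) / 2) ∧ EdgeCommon G a j ∧
  (1 < j →
    (∀ k ∈ Set.Icc 1 (j - 1),
      NoBranching G (a k) ∧ NoBranching G (a (cycleLength G / 2 + j - k))) →
    ∀ k ∈ Set.Icc 1 (j - 1), 1 < (treeAt G (a (cycleLength G / 2 + j - k))).ncard →
      treeLength G (a k) ≤ cycleLength G / 2 - j)

/-- `G ∈ 𝒪ₑ(ℓ, j) ∪ ℰₑ(ℓ, j)` with respect to the labelling `a`. -/
def EdgeOddOrEven (G : SimpleGraph V) [DecidableRel G.Adj] (a : ℕ → V) (j : ℕ) : Prop :=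
  EdgeOdd G a j ∨ EdgeEven G a j

end Finite

end Unicyclic

/-! Each edge off the cycle is directed towards it, so every vertex gets a parent, a height and a
root on the cycle (`exists_rooting`). Stretch the cycle to a circle of length 2ℓ, with a_i at 2i and
the midpoints of cycle edges at the odd points. Every edge then has a position p on this circle and
a doubled height t (`EdgeAt`). Twice its distance from s is 2·height(s) + circ(s, p) + t, except
that for s in the tree carrying the edge this is only an upper bound.

Edges at the same position are separated by any branch-resolving set that meets two trees
(`EdgeAt.eq_of_not_distinguished`). Edges at different positions p, q can be confused only if
circ(·, p) and circ(·, q) differ by one constant on all active positions. Three points that form a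
geodesic triple determine a point even up to such a shift (`eq_of_triple`), so a triple of active
vertices suffices. If the active vertices lie on an arc from a_0 to a_j shorter than half the cycle,
`positions_of_two` lists the four surviving configurations. The first three put an edge in a tree at
an end of the arc or just beyond it, which (i) and (ii) exclude. In the fourth, p lies inside the
arc, p + q = ℓ + 2j and the heights differ by ℓ - 2j; then p is the position of a tree edge too high
for (iii) or (iv). Conversely, each violated condition exhibits two undistinguished edges
(`edgeOddOrEven_of_isEdgeMetricGenerator`).

For the dimension: every generator is branch-resolving and does not live in one tree, nor in two
antipodal ones. The active trees of a minimum branch-resolving set are exactly those with a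
branching vertex (`IsMinResolving.mem_active_iff`), hence do not depend on the set. Completing two
active vertices to a geodesic triple costs one more vertex and gives the upper bounds. A generator
with one element fewer is so constrained that the necessity theorem applies to it. -/

open SimpleGraph

/-! ### Structure of a unicyclic graph: orienting the edges towards the cycle -/

namespace Unicyclic

variable {V : Type*} {G : SimpleGraph V}

/-- An orientation of the edges outside the cycle towards the cycle, together with the distance of
every vertex from the cycle. -/
structure Rooting (G : SimpleGraph V) where
  par : V → V
  height : V → ℕ
  conn : G.Connected
  height_eq_zero : ∀ v, height v = 0 ↔ v ∈ cycleVerts G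
  par_cycle : ∀ v ∈ cycleVerts G, par v = v
  adj_par : ∀ v, v ∉ cycleVerts G → G.Adj v (par v)
  height_par : ∀ v, v ∉ cycleVerts G → height v = height (par v) + 1
  adj_cases : ∀ u v, G.Adj u v →
    (u ∈ cycleVerts G ∧ v ∈ cycleVerts G) ∨ (u ∉ cycleVerts G ∧ par u = v) ∨
      (v ∉ cycleVerts G ∧ par v = u)
  mem_cycleEdges : ∀ u v, s(u, v) ∈ cycleEdges G ↔
    G.Adj u v ∧ u ∈ cycleVerts G ∧ v ∈ cycleVerts G
  three_le : 3 ≤ cycleLength G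
  adj_labelling : ∀ a, IsCycleLabelling G a → ∀ u v, G.Adj u v → u ∈ cycleVerts G →
    v ∈ cycleVerts G → ∃ i < cycleLength G, s(u, v) = s(a i, a ((i + 1) % cycleLength G))
  exists_labelling : ∃ a, IsCycleLabelling G a

lemma succ_mod {i l : ℕ} (h : i < l) : (i + 1) % l = if i + 1 = l then 0 else i + 1 := by
  split_ifs with h1
  · simp [h1]
  · exact Nat.mod_eq_of_lt (by omega)

/-- Cycles are unique only as subgraphs, so closed walks may differ in base point and direction. One
walk is fixed here, and every other cycle has the same vertices and edges. -/
lemma exists_cycle (hG : IsUnicyclic G) : ∃ (u : V) (p : G.Walk u u), p.IsCycle ∧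
    (∀ v, v ∈ cycleVerts G ↔ v ∈ p.support) ∧ (∀ e, e ∈ cycleEdges G ↔ e ∈ p.edges) ∧
    (∀ (w : V) (q : G.Walk w w), q.IsCycle → ∀ e, e ∈ q.edges ↔ e ∈ p.edges) := by
  obtain ⟨-, C, ⟨u, p, hp, rfl⟩, hu⟩ := hG
  have key : ∀ (w : V) (q : G.Walk w w), q.IsCycle → q.toSubgraph = p.toSubgraph :=
    fun w q hq => hu _ ⟨w, q, hq, rfl⟩
  have keyE : ∀ (w : V) (q : G.Walk w w), q.IsCycle → ∀ e, e ∈ q.edges ↔ e ∈ p.edges := by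
    intro w q hq e
    rw [← q.mem_edges_toSubgraph, key w q hq, p.mem_edges_toSubgraph]
  refine ⟨u, p, hp, fun v => ⟨?_, fun h => ⟨u, p, hp, h⟩⟩,
    fun e => ⟨?_, fun h => ⟨u, p, hp, h⟩⟩, keyE⟩
  · rintro ⟨w, q, hq, h⟩
    rw [← q.mem_verts_toSubgraph, key w q hq, p.mem_verts_toSubgraph] at h
    exact h
  · rintro ⟨w, q, hq, h⟩
    exact (keyE w q hq e).1 h

lemma cycleVerts_eq_image {u : V} {p : G.Walk u u} (hp : p.IsCycle)
    (hv : ∀ v, v ∈ cycleVerts G ↔ v ∈ p.support) :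
    Set.BijOn p.getVert (Set.Iio p.length) (cycleVerts G) := by
  have h3 := hp.three_le_length
  refine ⟨fun i _ => (hv _).2 (p.getVert_mem_support i), ?_, ?_⟩
  · intro i hi j hj h
    rw [Set.mem_Iio] at hi hj
    exact hp.getVert_injOn' (by simp; omega) (by simp; omega) h
  · intro v h
    obtain ⟨n, rfl, hn⟩ := Walk.mem_support_iff_exists_getVert.1 ((hv v).1 h)
    rcases hn.lt_or_eq with h1 | h1
    · exact ⟨n, h1, rfl⟩
    · exact ⟨0, by simp; omega, by rw [h1]; simp⟩

lemma cycleLength_eq {u : V} {p : G.Walk u u} (hp : p.IsCycle)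
    (hv : ∀ v, v ∈ cycleVerts G ↔ v ∈ p.support) : cycleLength G = p.length := by
  have h := cycleVerts_eq_image hp hv
  rw [cycleLength, ← h.image_eq, h.injOn.ncard_image, ← Finset.coe_Iio,
    Set.ncard_coe_finset]
  simp

lemma getVert_succ_mod {u : V} (p : G.Walk u u) {i : ℕ} (hi : i < p.length) :
    p.getVert ((i + 1) % p.length) = p.getVert (i + 1) := by
  rw [succ_mod hi]
  split_ifs with h
  · rw [h]; simp
  · rfl

lemma isCycleLabelling_getVert {u : V} {p : G.Walk u u} (hp : p.IsCycle)
    (hv : ∀ v, v ∈ cycleVerts G ↔ v ∈ p.support) : IsCycleLabelling G p.getVert := by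
  have hl := cycleLength_eq hp hv
  refine ⟨hl ▸ cycleVerts_eq_image hp hv, fun i hi => ?_⟩
  rw [hl] at hi ⊢
  rw [getVert_succ_mod p hi]
  exact p.adj_getVert_succ hi

/-- Deleting one cycle edge leaves a tree: the edge is no bridge, and any remaining cycle would have
to contain it. -/
lemma card_edgeFinset_eq [Fintype V] [Fintype G.edgeSet] (hG : IsUnicyclic G) :
    G.edgeFinset.card = Fintype.card V := by
  classical
  obtain ⟨u, p, hp, -, -, hc⟩ := exists_cycle hG
  have h3 := hp.three_le_length
  obtain ⟨e, he⟩ : ∃ e, e ∈ p.edges := by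
    apply List.exists_mem_of_length_pos
    rw [Walk.length_edges]; omega
  have heG : e ∈ G.edgeSet := p.edges_subset_edgeSet he
  have hb : ¬ G.IsBridge e := by
    rw [isBridge_iff_forall_cycle_notMem heG]
    exact fun h => h p hp he
  have hconn : (G.deleteEdges {e}).Connected := by
    induction e with | _ x y => exact hG.1.connected_delete_edge_of_not_isBridge hb
  have hacyc : (G.deleteEdges {e}).IsAcyclic := by
    intro w q hq
    have hq' := hq.mapLe (G.deleteEdges_le {e})
    have := (hc w _ hq' e).2 he
    rw [Walk.edges_mapLe_eq_edges] at this
    have := q.edges_subset_edgeSet this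
    simp at this
  have ht : (G.deleteEdges {e}).IsTree := ⟨hconn, hacyc⟩
  have h1 := ht.card_edgeFinset
  rw [← h1]
  have : (G.deleteEdges {e}).edgeFinset = G.edgeFinset.erase e := by
    ext f; simp [and_comm]
  rw [this, Finset.card_erase_add_one (by simpa using heG)]

/-- The point is that there are no edges besides the cycle edges of a labelling and the edges to
parents. These edges are indexed injectively by the vertices, and a unicyclic graph has as many
edges as vertices, so they are all the edges. -/
theorem exists_rooting [Finite V] (hG : IsUnicyclic G) : Nonempty (Rooting G) := by
  classical
  have := Fintype.ofFinite V
  obtain ⟨u, p, hp, hv, he, hc⟩ := exists_cycle hG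
  have hl := cycleLength_eq hp hv
  have h3 : 3 ≤ cycleLength G := hl ▸ hp.three_le_length
  have huC : u ∈ cycleVerts G := (hv u).2 p.start_mem_support
  have hex : ∀ v, ∃ n, ∃ c ∈ cycleVerts G, G.dist v c = n := fun v => ⟨_, u, huC, rfl⟩
  let h : V → ℕ := fun v => Nat.find (hex v)
  have h_spec : ∀ v, ∃ c ∈ cycleVerts G, G.dist v c = h v := fun v => Nat.find_spec (hex v)
  have h_le : ∀ v, ∀ c ∈ cycleVerts G, h v ≤ G.dist v c :=
    fun v c hc => Nat.find_min' (hex v) ⟨c, hc, rfl⟩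
  have h0 : ∀ v, h v = 0 ↔ v ∈ cycleVerts G := by
    intro v
    constructor
    · intro hz
      obtain ⟨c, hc, hd⟩ := h_spec v
      rw [hz, hG.1.dist_eq_zero_iff] at hd
      exact hd ▸ hc
    · intro hvC
      have := h_le v v hvC
      simpa using this
  have hpar : ∀ v, ∃ w, v ∉ cycleVerts G → G.Adj v w ∧ h v = h w + 1 := by
    intro v
    by_cases hvC : v ∈ cycleVerts G
    · exact ⟨v, fun h => absurd hvC h⟩
    obtain ⟨c, hc, hd⟩ := h_spec v
    -- The parent is the second vertex of a shortest walk to a nearest cycle vertex.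
    obtain ⟨q, hq⟩ := (hG.1.preconnected v c).exists_walk_length_eq_dist
    cases q with
    | nil => exact absurd hc hvC
    | @cons _ w _ hadj q =>
      refine ⟨w, fun _ => ⟨hadj, ?_⟩⟩
      rw [Walk.length_cons, hd] at hq
      have h1 := h_le w c hc
      have h2 := dist_le q
      obtain ⟨c', hc', hd'⟩ := h_spec w
      have h4 := h_le v c' hc'
      have h5 := hG.1.dist_triangle (u := v) (v := w) (w := c')
      have h6 := dist_eq_one_iff_adj.2 hadj
      omega
  choose par0 hpar0 using hpar
  let par : V → V := fun v => if v ∈ cycleVerts G then v else par0 v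
  have par_cyc : ∀ v ∈ cycleVerts G, par v = v := fun v hv => by simp [par, hv]
  have par_out : ∀ v, v ∉ cycleVerts G → G.Adj v (par v) ∧ h v = h (par v) + 1 := by
    intro v hv
    simpa [par, hv] using hpar0 v hv
  have hedge : ∀ a, IsCycleLabelling G a → ∀ x y, G.Adj x y →
      (∃ i < cycleLength G, s(x, y) = s(a i, a ((i + 1) % cycleLength G))) ∨
      (x ∉ cycleVerts G ∧ par x = y) ∨ (y ∉ cycleVerts G ∧ par y = x) := by
    intro a ha
    have hidx : ∀ c, ∃ i, c ∈ cycleVerts G → i < cycleLength G ∧ a i = c := by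
      intro c
      by_cases hcC : c ∈ cycleVerts G
      · obtain ⟨i, hi, hic⟩ := ha.1.surjOn hcC
        exact ⟨i, fun _ => ⟨hi, hic⟩⟩
      · exact ⟨0, fun h => absurd h hcC⟩
    choose idx hidx using hidx
    let f : V → Sym2 V := fun v => if v ∈ cycleVerts G then
      s(a (idx v), a ((idx v + 1) % cycleLength G)) else s(v, par v)
    have hmem : ∀ i, i < cycleLength G → a i ∈ cycleVerts G := fun i hi => ha.1.mapsTo hi
    have hlt : ∀ i, (i + 1) % cycleLength G < cycleLength G :=
      fun i => Nat.mod_lt _ (by omega)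
    have hf : Function.Injective f := by
      intro x y hxy
      by_cases hx : x ∈ cycleVerts G <;> by_cases hy : y ∈ cycleVerts G
      · simp only [f, hx, hy, if_true] at hxy
        obtain ⟨hi, hix⟩ := hidx x hx
        obtain ⟨hj, hjy⟩ := hidx y hy
        have inj := ha.1.injOn
        rw [Sym2.eq_iff] at hxy
        rcases hxy with ⟨h1, -⟩ | ⟨h1, h2⟩
        · rw [← hix, h1, hjy]
        · have e1 := inj hi (hlt _) h1
          have e2 := inj (hlt _) hj h2
          rw [succ_mod hj] at e1
          rw [succ_mod hi] at e2
          split_ifs at e1 e2 <;> omega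
      · simp only [f, hx, hy, if_true, if_false] at hxy
        obtain ⟨hi, hix⟩ := hidx x hx
        have : y ∈ s(a (idx x), a ((idx x + 1) % cycleLength G)) := by
          rw [hxy]; simp
        rcases Sym2.mem_iff.1 this with h | h
        · exact absurd (h ▸ hmem _ hi) hy
        · exact absurd (h ▸ hmem _ (hlt _)) hy
      · simp only [f, hx, hy, if_true, if_false] at hxy
        obtain ⟨hi, hix⟩ := hidx y hy
        have : x ∈ s(a (idx y), a ((idx y + 1) % cycleLength G)) := by
          rw [← hxy]; simp
        rcases Sym2.mem_iff.1 this with h | h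
        · exact absurd (h ▸ hmem _ hi) hx
        · exact absurd (h ▸ hmem _ (hlt _)) hx
      · simp only [f, hx, hy, if_false] at hxy
        rw [Sym2.eq_iff] at hxy
        rcases hxy with ⟨h1, -⟩ | ⟨h1, h2⟩
        · exact h1
        · have e1 := (par_out x hx).2
          have e2 := (par_out y hy).2
          rw [h2] at e1
          rw [← h1] at e2
          omega
    have hfm : ∀ v, f v ∈ G.edgeFinset := by
      intro v
      rw [mem_edgeFinset]
      by_cases hx : v ∈ cycleVerts G
      · simp only [f, hx, if_true]
        exact ha.2 _ (hidx v hx).1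
      · simp only [f, hx, if_false]
        exact (par_out v hx).1
    have himg : Finset.univ.image f = G.edgeFinset := by
      apply Finset.eq_of_subset_of_card_le
      · intro e he
        obtain ⟨v, -, rfl⟩ := Finset.mem_image.1 he
        exact hfm v
      · rw [Finset.card_image_of_injective _ hf, card_edgeFinset_eq hG, Finset.card_univ]
    intro x y hxy
    have : s(x, y) ∈ G.edgeFinset := by simpa using hxy
    rw [← himg] at this
    obtain ⟨v, -, hv⟩ := Finset.mem_image.1 this
    by_cases hx : v ∈ cycleVerts G
    · simp only [f, hx, if_true] at hv
      exact Or.inl ⟨_, (hidx v hx).1, hv.symm⟩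
    · simp only [f, hx, if_false] at hv
      rw [Sym2.eq_iff] at hv
      rcases hv with ⟨rfl, h2⟩ | ⟨rfl, h2⟩
      · exact Or.inr (Or.inl ⟨hx, h2⟩)
      · exact Or.inr (Or.inr ⟨hx, h2⟩)
  have hlab := isCycleLabelling_getVert hp hv
  have hcycadj : ∀ a, IsCycleLabelling G a → ∀ u v, G.Adj u v → u ∈ cycleVerts G →
      v ∈ cycleVerts G →
      ∃ i < cycleLength G, s(u, v) = s(a i, a ((i + 1) % cycleLength G)) := by
    intro a ha x y hxy hx hy
    rcases hedge a ha x y hxy with h | h | h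
    · exact h
    · exact absurd hx h.1
    · exact absurd hy h.1
  refine ⟨⟨par, h, hG.1, h0, par_cyc, fun v hv => (par_out v hv).1, fun v hv => (par_out v hv).2,
    ?_, ?_, h3, hcycadj, ⟨_, hlab⟩⟩⟩
  · intro x y hxy
    rcases hedge _ hlab x y hxy with ⟨i, hi, h⟩ | h | h
    · left
      have hi1 := hlab.1.mapsTo hi
      have hi2 := hlab.1.mapsTo (show (i + 1) % cycleLength G ∈ Set.Iio _ from
        Nat.mod_lt _ (by omega))
      rw [Sym2.eq_iff] at h
      rcases h with ⟨rfl, rfl⟩ | ⟨rfl, rfl⟩ <;> constructor <;> assumption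
    · exact Or.inr (Or.inl h)
    · exact Or.inr (Or.inr h)
  · intro x y
    rw [he]
    constructor
    · intro h
      exact ⟨p.edges_subset_edgeSet h, (hv x).2 (p.fst_mem_support_of_mem_edges h),
        (hv y).2 (p.snd_mem_support_of_mem_edges h)⟩
    · rintro ⟨hxy, hx, hy⟩
      obtain ⟨i, hi, h⟩ := hcycadj _ hlab x y hxy hx hy
      rw [hl] at hi h
      rw [h, getVert_succ_mod p hi]
      rw [← Walk.mem_edges_toSubgraph, Subgraph.mem_edgeSet]
      exact p.toSubgraph_adj_getVert hi

end Unicyclic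

/-! ### Distances in terms of heights and roots -/

namespace Unicyclic

variable {V : Type*} {G : SimpleGraph V}

/-- Source of the lower bounds on distances below: each one comes from a suitable 1-Lipschitz test
function. -/
lemma le_add_dist_of_lipschitz (hG : G.Connected) (f : V → ℤ)
    (hf : ∀ u v, G.Adj u v → f u ≤ f v + 1) (u v : V) : f u ≤ f v + G.dist u v := by
  obtain ⟨p, hp⟩ := (hG.preconnected u v).exists_walk_length_eq_dist
  rw [← hp]
  clear hp
  induction p with
  | nil => simp
  | cons h p ih =>
    have := hf _ _ h
    rw [Walk.length_cons]
    push_cast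
    omega

lemma edgeDist_mk (u x y : V) : edgeDist G u s(x, y) = min (G.dist u x) (G.dist u y) := rfl

namespace Rooting

variable (R : Rooting G)

/-- The vertices separated from the cycle by `x` (including `x`). -/
def desc (x : V) : Set V := {v | ∃ n, R.par^[n] v = x}

/-- The cycle vertex closest to `v`. -/
def root (v : V) : V := R.par^[R.height v] v

lemma self_mem_desc (x : V) : x ∈ R.desc x := ⟨0, rfl⟩

lemma mem_desc_of_par {x v : V} (h : R.par v ∈ R.desc x) : v ∈ R.desc x := by
  obtain ⟨n, hn⟩ := h
  exact ⟨n + 1, hn⟩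

lemma par_mem_desc {x v : V} (h : v ∈ R.desc x) (hv : v ≠ x) : R.par v ∈ R.desc x := by
  obtain ⟨n, hn⟩ := h
  cases n with
  | zero => exact absurd hn hv
  | succ n => exact ⟨n, hn⟩

lemma desc_trans {x y z : V} (h : x ∈ R.desc y) (h' : y ∈ R.desc z) : x ∈ R.desc z := by
  obtain ⟨n, rfl⟩ := h
  obtain ⟨m, rfl⟩ := h'
  exact ⟨m + n, Function.iterate_add_apply _ _ _ _⟩

lemma iterate_par_cycle {c : V} (hc : c ∈ cycleVerts G) (n : ℕ) : R.par^[n] c = c :=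
  Function.iterate_fixed (R.par_cycle c hc) n

lemma height_par_eq (v : V) : R.height (R.par v) = R.height v - 1 := by
  by_cases hv : v ∈ cycleVerts G
  · have := (R.height_eq_zero v).2 hv
    rw [R.par_cycle v hv]; omega
  · have := R.height_par v hv
    omega

lemma height_iterate (n : ℕ) (v : V) : R.height (R.par^[n] v) = R.height v - n := by
  induction n with
  | zero => simp
  | succ n ih => rw [Function.iterate_succ_apply', height_par_eq, ih]; omega

lemma root_mem (v : V) : R.root v ∈ cycleVerts G := by
  rw [← R.height_eq_zero, root, height_iterate]; omega

lemma root_cycle {c : V} (hc : c ∈ cycleVerts G) : R.root c = c := R.iterate_par_cycle hc _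

lemma root_par (v : V) : R.root (R.par v) = R.root v := by
  by_cases hv : v ∈ cycleVerts G
  · rw [R.par_cycle v hv]
  · rw [root, root, R.height_par v hv, Function.iterate_succ_apply]

lemma root_iterate (n : ℕ) (v : V) : R.root (R.par^[n] v) = R.root v := by
  induction n with
  | zero => rfl
  | succ n ih => rw [Function.iterate_succ_apply', root_par, ih]

lemma root_eq_of_mem_desc {x v : V} (h : v ∈ R.desc x) : R.root v = R.root x := by
  obtain ⟨n, rfl⟩ := h
  rw [root_iterate]

lemma mem_desc_root (v : V) : v ∈ R.desc (R.root v) := ⟨_, rfl⟩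

lemma height_le_of_mem_desc {x v : V} (h : v ∈ R.desc x) : R.height x ≤ R.height v := by
  obtain ⟨n, rfl⟩ := h
  rw [height_iterate]; omega

lemma height_pos {x : V} (hx : x ∉ cycleVerts G) : 0 < R.height x := by
  rw [← R.height_eq_zero] at hx; omega

lemma notMem_cycle_of_mem_desc {x v : V} (hx : x ∉ cycleVerts G) (h : v ∈ R.desc x) :
    v ∉ cycleVerts G := by
  have h1 := R.height_le_of_mem_desc h
  rw [← R.height_eq_zero] at hx ⊢
  omega

lemma cycle_notMem_desc {x v : V} (hx : x ∉ cycleVerts G) (h : v ∈ cycleVerts G) :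
    v ∉ R.desc x := fun h' => R.notMem_cycle_of_mem_desc hx h' h

lemma eq_of_mem_desc_of_height {x v : V} (h : v ∈ R.desc x) (hh : R.height v = R.height x)
    (hx : x ∉ cycleVerts G) : v = x := by
  by_contra hne
  have h1 := R.height_le_of_mem_desc (R.par_mem_desc h hne)
  have h2 := R.height_par v (R.notMem_cycle_of_mem_desc hx h)
  omega

lemma par_notMem_desc {x : V} (hx : x ∉ cycleVerts G) : R.par x ∉ R.desc x := by
  intro h
  have h1 := R.height_le_of_mem_desc h
  have h2 := R.height_par x hx
  omega

lemma desc_comparable {x y v : V} (hx : v ∈ R.desc x) (hy : v ∈ R.desc y) :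
    x ∈ R.desc y ∨ y ∈ R.desc x := by
  obtain ⟨n, rfl⟩ := hx
  obtain ⟨m, rfl⟩ := hy
  rcases le_total n m with h | h
  · left; exact ⟨m - n, by rw [← Function.iterate_add_apply]; congr 2; omega⟩
  · right; exact ⟨n - m, by rw [← Function.iterate_add_apply]; congr 2; omega⟩

lemma eq_of_mem_desc_of_mem_desc {x y v : V} (hx : v ∈ R.desc x) (hy : v ∈ R.desc y)
    (hh : R.height x = R.height y) (hx' : x ∉ cycleVerts G) (hy' : y ∉ cycleVerts G) :
    x = y := by
  rcases R.desc_comparable hx hy with h | h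
  · exact R.eq_of_mem_desc_of_height h hh hy'
  · exact (R.eq_of_mem_desc_of_height h hh.symm hx').symm

/-- A vertex outside the cycle lies below a child of its root. -/
lemma exists_top {v : V} (hv : v ∉ cycleVerts G) :
    ∃ x, x ∉ cycleVerts G ∧ v ∈ R.desc x ∧ R.par x = R.root v := by
  have h := R.height_pos hv
  refine ⟨R.par^[R.height v - 1] v, ?_, ⟨_, rfl⟩, ?_⟩
  · rw [← R.height_eq_zero, height_iterate]; omega
  · rw [root, ← Function.iterate_succ_apply' R.par]; congr 2; omega

lemma dist_iterate (n : ℕ) (v : V) :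
    G.dist v (R.par^[n] v) + R.height (R.par^[n] v) ≤ R.height v := by
  induction n with
  | zero => simp
  | succ n ih =>
    rw [Function.iterate_succ_apply']
    set w := R.par^[n] v
    by_cases hw : w ∈ cycleVerts G
    · rwa [R.par_cycle w hw]
    · have h1 := R.height_par w hw
      have h2 := dist_eq_one_iff_adj.2 (R.adj_par w hw)
      have h3 := R.conn.dist_triangle (u := v) (v := w) (w := R.par w)
      omega

lemma dist_le_of_mem_desc {x v : V} (h : v ∈ R.desc x) :
    G.dist v x + R.height x ≤ R.height v := by
  obtain ⟨n, rfl⟩ := h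
  exact R.dist_iterate n v

lemma dist_root_le (v : V) : G.dist v (R.root v) ≤ R.height v := by
  have := R.dist_le_of_mem_desc (R.mem_desc_root v)
  omega

lemma dist_le (u v : V) :
    G.dist u v ≤ R.height u + G.dist (R.root u) (R.root v) + R.height v := by
  have h1 := R.dist_root_le u
  have h2 := R.dist_root_le v
  rw [dist_comm] at h2
  have h3 := R.conn.dist_triangle (u := u) (v := R.root u) (w := v)
  have h4 := R.conn.dist_triangle (u := R.root u) (v := R.root v) (w := v)
  omega

lemma le_add_dist (f : V → ℤ)
    (hf : ∀ x, x ∉ cycleVerts G → f x ≤ f (R.par x) + 1 ∧ f (R.par x) ≤ f x + 1)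
    (hc : ∀ u v, G.Adj u v → u ∈ cycleVerts G → v ∈ cycleVerts G → f u ≤ f v + 1) (u v : V) :
    f u ≤ f v + G.dist u v := by
  refine le_add_dist_of_lipschitz R.conn f (fun x y h => ?_) u v
  rcases R.adj_cases x y h with h' | ⟨h', rfl⟩ | ⟨h', rfl⟩
  · exact hc x y h h'.1 h'.2
  · exact (hf x h').1
  · exact (hf y h').2

lemma height_cycle {c : V} (hc : c ∈ cycleVerts G) : R.height c = 0 := (R.height_eq_zero c).2 hc

lemma dist_eq_of_root_ne {u v : V} (h : R.root u ≠ R.root v) :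
    G.dist u v = R.height u + G.dist (R.root u) (R.root v) + R.height v := by
  classical
  refine le_antisymm (R.dist_le u v) ?_
  -- The test function is the distance from the root of `u`, with a negative sign on the tree of
  -- `u`.
  have := R.le_add_dist (fun x => if R.root x = R.root u then -(R.height x : ℤ) else
    G.dist (R.root u) (R.root x) + R.height x) ?_ ?_ v u
  · rw [dist_comm (u := v) (v := u)] at this
    simp only [h.symm, if_true, if_false] at this
    omega
  · intro x hx
    have h1 := R.height_par x hx
    simp only [R.root_par]
    split_ifs <;> constructor <;> omega
  · intro x y hxy hx hy
    have key : ∀ z ∈ cycleVerts G, (if R.root z = R.root u then -(R.height z : ℤ) else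
        G.dist (R.root u) (R.root z) + R.height z) = G.dist (R.root u) z := by
      intro z hz
      rw [R.root_cycle hz, R.height_cycle hz]
      split_ifs with h'
      · simp [h']
      · simp
    simp only [key x hx, key y hy]
    have h1 := dist_eq_one_iff_adj.2 hxy.symm
    have h2 := R.conn.dist_triangle (u := R.root u) (v := y) (w := x)
    omega

lemma height_le_dist {c : V} (hc : c ∈ cycleVerts G) (u : V) : R.height u ≤ G.dist u c := by
  have := R.le_add_dist (fun x => R.height x) ?_ ?_ u c
  · simpa [R.height_cycle hc] using this
  · intro x hx
    have h1 := R.height_par x hx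
    constructor <;> omega
  · intro x y _ hx hy
    simp [R.height_cycle hx, R.height_cycle hy]

lemma dist_cycle {c : V} (hc : c ∈ cycleVerts G) (u : V) :
    G.dist u c = R.height u + G.dist (R.root u) c := by
  by_cases h : R.root u = R.root c
  · rw [R.root_cycle hc] at h
    have h1 := R.dist_root_le u
    have h2 := R.height_le_dist hc u
    rw [h] at h1 ⊢
    simp; omega
  · have := R.dist_eq_of_root_ne h
    rwa [R.root_cycle hc, R.height_cycle hc] at this

/-- Every path leaving the subtree below `x` passes through `par x`, which has height `height x -
1`. -/
lemma dist_ge_of_separated {x u v : V} (hx : x ∉ cycleVerts G) (hu : u ∈ R.desc x)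
    (hv : v ∉ R.desc x) : R.height u + R.height v + 2 ≤ G.dist u v + 2 * R.height x := by
  classical
  have h0 := R.height_par x hx
  -- Height relative to `par x`, with the sign reversed below `x`, so that crossing the edge at `x`
  -- does not fold the function back.
  have := R.le_add_dist (fun w => if w ∈ R.desc x then (R.height (R.par x) : ℤ) - R.height w else
    (R.height w : ℤ) - R.height (R.par x)) ?_ ?_ v u
  · rw [dist_comm] at this
    simp only [hu, hv, if_true, if_false] at this
    omega
  · intro y hy
    have h1 := R.height_par y hy
    by_cases hyx : y = x
    · subst hyx
      simp only [R.par_notMem_desc hx, R.self_mem_desc, if_true, if_false]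
      constructor <;> omega
    · have : R.par y ∈ R.desc x ↔ y ∈ R.desc x :=
        ⟨R.mem_desc_of_par, fun h => R.par_mem_desc h hyx⟩
      simp only [this]
      split_ifs <;> constructor <;> omega
  · intro y z _ hy hz
    simp [R.cycle_notMem_desc hx hy, R.cycle_notMem_desc hx hz, R.height_cycle hy,
      R.height_cycle hz]

lemma dist_par_le_of_notMem_desc {x s : V} (hx : x ∉ cycleVerts G) (hs : s ∉ R.desc x) :
    G.dist s (R.par x) ≤ G.dist s x := by
  classical
  -- Distance from `s` after collapsing the subtree below `x` onto `par x`.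
  have := R.le_add_dist (fun w => if w ∈ R.desc x then (G.dist s (R.par x) : ℤ) else
    G.dist s w) ?_ ?_ x s
  · rw [dist_comm] at this
    simp only [R.self_mem_desc, hs, if_true, if_false] at this
    simpa [dist_comm] using this
  · intro y hy
    by_cases hyx : y = x
    · subst hyx
      simp [R.par_notMem_desc hx, R.self_mem_desc]
    · have h1 : R.par y ∈ R.desc x ↔ y ∈ R.desc x :=
        ⟨R.mem_desc_of_par, fun h => R.par_mem_desc h hyx⟩
      have h2 := dist_eq_one_iff_adj.2 (R.adj_par y hy)
      have h3 := R.conn.dist_triangle (u := s) (v := y) (w := R.par y)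
      have h4 := R.conn.dist_triangle (u := s) (v := R.par y) (w := y)
      rw [dist_comm (u := R.par y)] at h4
      simp only [h1]
      split_ifs <;> constructor <;> omega
  · intro y z hyz hy hz
    simp only [R.cycle_notMem_desc hx hy, R.cycle_notMem_desc hx hz, if_false]
    have h1 := dist_eq_one_iff_adj.2 hyz.symm
    have h2 := R.conn.dist_triangle (u := s) (v := z) (w := y)
    omega

lemma edgeDist_par_of_notMem_desc {x s : V} (hx : x ∉ cycleVerts G) (hs : s ∉ R.desc x) :
    edgeDist G s s(x, R.par x) = G.dist s (R.par x) := by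
  rw [edgeDist_mk]
  exact min_eq_right (R.dist_par_le_of_notMem_desc hx hs)

/-- Counterpart of `edgeDist_le_of_mem_desc`: for two edges of equal height, one below `x` and one
not, the bounds leave a gap of 1, so a vertex below `x` tells them apart. -/
lemma edgeDist_ge_of_separated {x s y : V} (hx : x ∉ cycleVerts G) (hs : s ∈ R.desc x)
    (hy : y ∉ R.desc x) (hyC : y ∉ cycleVerts G) :
    R.height s + R.height y + 1 ≤ edgeDist G s s(y, R.par y) + 2 * R.height x := by
  rw [edgeDist_mk]
  have h1 := R.dist_ge_of_separated hx hs hy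
  have h2 := R.dist_ge_of_separated hx hs (fun h => hy (R.mem_desc_of_par h))
  have h3 := R.height_par y hyC
  omega

lemma edgeDist_le_of_mem_desc {x s y : V} (hx : x ∉ cycleVerts G) (hs : s ∈ R.desc x)
    (hy : y ∈ R.desc x) :
    edgeDist G s s(y, R.par y) + 2 * R.height x ≤ R.height s + R.height y := by
  rw [edgeDist_mk]
  have h1 := R.dist_le_of_mem_desc hs
  by_cases hyx : y = x
  · subst hyx
    omega
  · have h2 := R.dist_le_of_mem_desc (R.par_mem_desc hy hyx)
    have h3 := R.height_par y (R.notMem_cycle_of_mem_desc hx hy)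
    have h4 := R.conn.dist_triangle (u := s) (v := x) (w := R.par y)
    rw [dist_comm (u := x)] at h4
    omega

/-- The detour through the roots is always available; it is forced only when the roots differ, as in
`edgeDist_par_eq`. -/
lemma edgeDist_par_le (s : V) {y : V} (hy : y ∉ cycleVerts G) :
    edgeDist G s s(y, R.par y) + 1 ≤ R.height s + G.dist (R.root s) (R.root y) + R.height y := by
  rw [edgeDist_mk]
  have h1 := R.dist_le s (R.par y)
  have h2 := R.height_par y hy
  rw [R.root_par] at h1
  omega

lemma edgeDist_par_eq {s y : V} (hy : y ∉ cycleVerts G) (h : R.root s ≠ R.root y) :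
    edgeDist G s s(y, R.par y) + 1 = R.height s + G.dist (R.root s) (R.root y) + R.height y := by
  rw [edgeDist_mk, R.dist_eq_of_root_ne h,
    R.dist_eq_of_root_ne (show R.root s ≠ R.root (R.par y) by rwa [R.root_par]), R.root_par]
  have h2 := R.height_par y hy
  omega

lemma edgeDist_cycle (s : V) {u v : V} (hu : u ∈ cycleVerts G) (hv : v ∈ cycleVerts G) :
    edgeDist G s s(u, v) =
      R.height s + min (G.dist (R.root s) u) (G.dist (R.root s) v) := by
  rw [edgeDist_mk, R.dist_cycle hu, R.dist_cycle hv]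
  omega

/-- Edges off the cycle preserve roots, and iterating the parent map joins a vertex to its root
without using cycle edges. -/
lemma treeAt_eq {c : V} (hc : c ∈ cycleVerts G) : treeAt G c = {v | R.root v = c} := by
  have hadj : ∀ u v, (G.deleteEdges (cycleEdges G)).Adj u v → R.root u = R.root v := by
    intro u v h
    rw [deleteEdges_adj, R.mem_cycleEdges] at h
    rcases R.adj_cases u v h.1 with h' | ⟨h', rfl⟩ | ⟨h', rfl⟩
    · exact absurd ⟨h.1, h'⟩ h.2
    · rw [R.root_par]
    · rw [R.root_par]
  have hpar : ∀ v, (G.deleteEdges (cycleEdges G)).Reachable v (R.par v) := by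
    intro v
    by_cases hv : v ∈ cycleVerts G
    · rw [R.par_cycle v hv]
    · apply Adj.reachable
      rw [deleteEdges_adj, R.mem_cycleEdges]
      exact ⟨R.adj_par v hv, fun h => hv h.2.1⟩
  have hiter : ∀ n v, (G.deleteEdges (cycleEdges G)).Reachable v (R.par^[n] v) := by
    intro n v
    induction n with
    | zero => rfl
    | succ n ih => rw [Function.iterate_succ_apply']; exact ih.trans (hpar _)
  ext v
  constructor
  · rintro ⟨p⟩
    have : ∀ {u w} (q : (G.deleteEdges (cycleEdges G)).Walk u w), R.root u = R.root w := by
      intro u w q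
      induction q with
      | nil => rfl
      | cons h q ih => exact (hadj _ _ h).trans ih
    have h2 := this p
    rw [R.root_cycle hc] at h2
    exact h2.symm
  · rintro rfl
    exact (hiter _ _).symm

lemma mem_treeAt_iff {c v : V} (hc : c ∈ cycleVerts G) : v ∈ treeAt G c ↔ R.root v = c := by
  rw [R.treeAt_eq hc]; rfl

lemma mem_activeVerts_iff {c : V} {S : Finset V} :
    c ∈ activeVerts G S ↔ ∃ s ∈ S, R.root s = c := by
  constructor
  · rintro ⟨hc, s, hs, h⟩
    exact ⟨s, hs, (R.mem_treeAt_iff hc).1 h⟩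
  · rintro ⟨s, hs, rfl⟩
    exact ⟨R.root_mem s, s, hs, (R.mem_treeAt_iff (R.root_mem s)).2 rfl⟩

end Rooting

/-! ### Labellings of the cycle and circular distance -/

/-- The distance between `p` and `q` on a cycle of length `n`. -/
def circDist (n p q : ℕ) : ℕ := min (p - q + (q - p)) (n - (p - q + (q - p)))

/-- The index in `[0, ℓ - 1]` of a cycle vertex with respect to a labelling. -/
noncomputable def cycleIdx (G : SimpleGraph V) (a : ℕ → V) (c : V) : ℕ :=
  sInf {i | i < cycleLength G ∧ a i = c}

section Labelling

variable {a : ℕ → V}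

lemma IsCycleLabelling.mem (ha : IsCycleLabelling G a) {i : ℕ} (hi : i < cycleLength G) :
    a i ∈ cycleVerts G :=
  ha.1.mapsTo hi

lemma IsCycleLabelling.inj (ha : IsCycleLabelling G a) {i j : ℕ} (hi : i < cycleLength G)
    (hj : j < cycleLength G) (h : a i = a j) : i = j := ha.1.injOn hi hj h

lemma IsCycleLabelling.cycleIdx_spec (ha : IsCycleLabelling G a) {c : V}
    (hc : c ∈ cycleVerts G) : cycleIdx G a c < cycleLength G ∧ a (cycleIdx G a c) = c :=
  Nat.sInf_mem (s := {i | i < cycleLength G ∧ a i = c}) (ha.1.surjOn hc)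

lemma IsCycleLabelling.cycleIdx_lt (ha : IsCycleLabelling G a) {c : V} (hc : c ∈ cycleVerts G) :
    cycleIdx G a c < cycleLength G := (ha.cycleIdx_spec hc).1

lemma IsCycleLabelling.apply_cycleIdx (ha : IsCycleLabelling G a) {c : V}
    (hc : c ∈ cycleVerts G) : a (cycleIdx G a c) = c := (ha.cycleIdx_spec hc).2

lemma IsCycleLabelling.cycleIdx_apply (ha : IsCycleLabelling G a) {i : ℕ}
    (hi : i < cycleLength G) : cycleIdx G a (a i) = i :=
  ha.inj (ha.cycleIdx_lt (ha.mem hi)) hi (ha.apply_cycleIdx (ha.mem hi))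

lemma IsCycleLabelling.dist_le_sub (ha : IsCycleLabelling G a) (hG : G.Connected) {i : ℕ} (n : ℕ)
    (hi : i + n < cycleLength G) : G.dist (a i) (a (i + n)) ≤ n := by
  induction n with
  | zero => simp
  | succ n ih =>
    have h1 := ih (by omega)
    have h2 := ha.2 (i + n) (by omega)
    rw [Nat.mod_eq_of_lt (by omega)] at h2
    have h3 := dist_eq_one_iff_adj.2 h2
    have h4 := hG.dist_triangle (u := a i) (v := a (i + n)) (w := a (i + n + 1))
    rw [← add_assoc]
    omega

lemma IsCycleLabelling.dist_le_circDist (ha : IsCycleLabelling G a) (R : Rooting G) {i j : ℕ}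
    (hij : i ≤ j) (hj : j < cycleLength G) :
    G.dist (a i) (a j) ≤ circDist (cycleLength G) i j := by
  have h1 := ha.dist_le_sub R.conn (i := i) (j - i) (by omega)
  have h2 := ha.dist_le_sub R.conn (i := 0) i (by omega)
  have h3 := ha.dist_le_sub R.conn (i := j) (cycleLength G - 1 - j) (by omega)
  have h4 := ha.2 (cycleLength G - 1) (by omega)
  rw [show cycleLength G - 1 + 1 = cycleLength G by omega, Nat.mod_self] at h4
  have h5 := dist_eq_one_iff_adj.2 h4
  rw [show i + (j - i) = j by omega] at h1
  rw [zero_add] at h2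
  rw [show j + (cycleLength G - 1 - j) = cycleLength G - 1 by omega] at h3
  have h6 := R.conn.dist_triangle (u := a j) (v := a (cycleLength G - 1)) (w := a 0)
  have h7 := R.conn.dist_triangle (u := a j) (v := a 0) (w := a i)
  rw [dist_comm (u := a j) (v := a i)] at h7
  rw [circDist]
  omega

/-- Distances between cycle vertices are distances on the cycle. -/
lemma IsCycleLabelling.dist_eq (ha : IsCycleLabelling G a) (R : Rooting G) {i j : ℕ}
    (hi : i < cycleLength G) (hj : j < cycleLength G) :
    G.dist (a i) (a j) = circDist (cycleLength G) i j := by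
  apply le_antisymm
  · rcases le_total i j with h | h
    · exact ha.dist_le_circDist R h hj
    · rw [dist_comm]
      have := ha.dist_le_circDist R h hi
      rw [circDist] at this ⊢
      omega
  -- The circular distance from index `i` to the index of the root is constant on trees and changes
  -- by at most 1 along a cycle edge.
  · have := R.le_add_dist (fun w => (circDist (cycleLength G) i (cycleIdx G a (R.root w)) : ℤ))
      ?_ ?_ (a j) (a i)
    · rw [R.root_cycle (ha.mem hi), R.root_cycle (ha.mem hj), ha.cycleIdx_apply hi,
        ha.cycleIdx_apply hj, dist_comm] at this
      have h0 : circDist (cycleLength G) i i = 0 := by simp [circDist]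
      rw [h0] at this
      omega
    · intro x hx
      rw [R.root_par]; omega
    · intro u v huv hu hv
      obtain ⟨k, hk, he⟩ := R.adj_labelling a ha u v huv hu hv
      have hk' : (k + 1) % cycleLength G < cycleLength G := Nat.mod_lt _ (by omega)
      have hs := succ_mod hk
      rw [R.root_cycle hu, R.root_cycle hv]
      simp only [circDist]
      rw [Sym2.eq_iff] at he
      rcases he with ⟨rfl, rfl⟩ | ⟨rfl, rfl⟩ <;>
      · rw [ha.cycleIdx_apply hk, ha.cycleIdx_apply hk']
        split_ifs at hs <;> omega

end Labelling

end Unicyclic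

/-! ### Threads and branch-resolving sets in terms of descendants -/

namespace Unicyclic

variable {V : Type*} {G : SimpleGraph V}

lemma exists_cycle_neighbors (R : Rooting G) {c : V} (hc : c ∈ cycleVerts G) :
    ∃ u w, u ∈ cycleVerts G ∧ w ∈ cycleVerts G ∧ u ≠ w ∧ G.Adj c u ∧ G.Adj c w ∧
      ∀ x ∈ cycleVerts G, G.Adj c x → x = u ∨ x = w := by
  obtain ⟨a, ha⟩ := R.exists_labelling
  have h3 := R.three_le
  obtain ⟨i, hi, rfl⟩ := ha.1.surjOn hc
  change i < cycleLength G at hi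
  obtain ⟨j, hj, hji⟩ : ∃ j < cycleLength G, (j + 1) % cycleLength G = i := by
    rcases Nat.eq_zero_or_pos i with rfl | h
    · exact ⟨cycleLength G - 1, by omega, by rw [Nat.sub_add_cancel (by omega), Nat.mod_self]⟩
    · exact ⟨i - 1, by omega, by rw [Nat.sub_add_cancel h, Nat.mod_eq_of_lt hi]⟩
  have hi' : (i + 1) % cycleLength G < cycleLength G := Nat.mod_lt _ (by omega)
  refine ⟨a ((i + 1) % cycleLength G), a j, ha.mem hi', ha.mem hj, ?_, ha.2 i hi, ?_, ?_⟩
  · intro h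
    have h1 := ha.inj hi' hj h
    have h2 := succ_mod hi
    have h4 := succ_mod hj
    split_ifs at h2 h4 <;> omega
  · have := ha.2 j hj
    rw [hji] at this
    exact this.symm
  · intro x hx hadj
    obtain ⟨k, hk, he⟩ := R.adj_labelling a ha _ _ hadj hc hx
    rw [Sym2.eq_iff] at he
    rcases he with ⟨h1, rfl⟩ | ⟨h1, rfl⟩
    · left
      rw [ha.inj hi hk h1]
    · right
      have h4 := ha.inj hi (Nat.mod_lt _ (by omega)) h1
      have h2 := succ_mod hk
      have h5 := succ_mod hj
      congr 1
      split_ifs at h2 h5 <;> omega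

namespace Rooting

variable (R : Rooting G)

lemma mem_desc_iff {x y : V} : y ∈ R.desc x ↔
    y = x ∨ ∃ z, z ∉ cycleVerts G ∧ R.par z = x ∧ y ∈ R.desc z := by
  constructor
  · rintro ⟨n, rfl⟩
    induction n with
    | zero => exact Or.inl rfl
    | succ n ih =>
      rw [Function.iterate_succ_apply']
      by_cases hz : R.par^[n] y ∈ cycleVerts G
      · rw [R.par_cycle _ hz]; exact ih
      · exact Or.inr ⟨_, hz, rfl, n, rfl⟩
  · rintro (rfl | ⟨z, -, rfl, h⟩)
    · exact R.self_mem_desc y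
    · exact R.desc_trans h (R.mem_desc_of_par (R.self_mem_desc _))

lemma mem_desc_par (x : V) : x ∈ R.desc (R.par x) := R.mem_desc_of_par (R.self_mem_desc _)

lemma par_ne_child {v x : V} (hv : v ∉ cycleVerts G) (hx : x ∉ cycleVerts G)
    (hxv : R.par x = v) : R.par v ≠ x := by
  intro h
  have h1 := R.height_par v hv
  have h2 := R.height_par x hx
  rw [hxv] at h2
  rw [h] at h1
  omega

/-- Induction from the leaves towards the cycle, on the number of descendants. -/
lemma desc_induction [Finite V] {P : V → Prop}
    (h : ∀ x, x ∉ cycleVerts G → (∀ y, y ∉ cycleVerts G → R.par y = x → P y) → P x) :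
    ∀ x, x ∉ cycleVerts G → P x := by
  have : ∀ n x, x ∉ cycleVerts G → (R.desc x).ncard = n → P x := by
    intro n
    induction n using Nat.strong_induction_on with
    | _ n ih =>
      rintro x hx rfl
      refine h x hx fun y hy hyx => ih _ ?_ y hy rfl
      apply Set.ncard_lt_ncard _ (Set.toFinite _)
      subst hyx
      refine ⟨fun z hz => R.desc_trans hz (R.mem_desc_par y), fun hs => ?_⟩
      exact R.par_notMem_desc hy (hs (R.self_mem_desc _))
  exact fun x hx => this _ x hx rfl

end Rooting

section Degree

variable [Fintype V] [DecidableRel G.Adj]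

lemma card_le_degree {v : V} (s : Finset V) (h : ∀ x ∈ s, G.Adj v x) : s.card ≤ G.degree v := by
  rw [← G.card_neighborFinset_eq_degree]
  exact Finset.card_le_card fun x hx => by simpa using h x hx

lemma degree_le_card {v : V} (s : Finset V) (h : ∀ x, G.Adj v x → x ∈ s) :
    G.degree v ≤ s.card := by
  rw [← G.card_neighborFinset_eq_degree]
  exact Finset.card_le_card fun x hx => h x (by simpa using hx)

lemma three_le_degree {v x y z : V} (hx : G.Adj v x) (hy : G.Adj v y) (hz : G.Adj v z)
    (hxy : x ≠ y) (hxz : x ≠ z) (hyz : y ≠ z) : 3 ≤ G.degree v := by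
  classical
  have := card_le_degree (G := G) (v := v) {x, y, z} (by simp [hx, hy, hz])
  rwa [Finset.card_eq_three.2 ⟨x, y, z, hxy, hxz, hyz, rfl⟩] at this

/-- A thread, without the requirement on the degree of the vertex it is attached to. -/
def IsThreadFrom (G : SimpleGraph V) [DecidableRel G.Adj] (v : V) (l : List V) : Prop :=
  (v :: l).Nodup ∧ List.IsChain G.Adj (v :: l) ∧
    (∀ x ∈ l.dropLast, G.degree x = 2) ∧ ∃ w, l.getLast? = some w ∧ G.degree w = 1

/-- Vertices of a thread have degree at most 2, so the attaching vertex, of degree at least 3, is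
never among them. Dropping the degree condition gives a notion that survives passing to the tail, as
inductions need. -/
lemma isThread_iff {v : V} {l : List V} :
    IsThread G v l ↔ 3 ≤ G.degree v ∧ IsThreadFrom G v l := by
  constructor
  · rintro ⟨h3, hn, hc, hd, w, hw, hw1⟩
    refine ⟨h3, List.nodup_cons.2 ⟨fun hv => ?_, hn⟩, hc, hd, w, hw, hw1⟩
    rw [← List.dropLast_append_getLast? w hw, List.mem_append, List.mem_singleton] at hv
    rcases hv with hv | rfl
    · have := hd v hv; omega
    · omega
  · rintro ⟨h3, hn, hc, hd, h⟩
    exact ⟨h3, (List.nodup_cons.1 hn).2, hc, hd, h⟩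

lemma isThreadFrom_singleton {v x : V} (h : IsThreadFrom G v [x]) :
    G.Adj v x ∧ G.degree x = 1 := by
  obtain ⟨-, hc, -, w, hw, hw1⟩ := h
  simp at hc hw
  exact ⟨hc, hw ▸ hw1⟩

lemma isThreadFrom_cons_cons {v x y : V} {l : List V} :
    IsThreadFrom G v (x :: y :: l) ↔
      v ≠ x ∧ v ∉ y :: l ∧ G.Adj v x ∧ G.degree x = 2 ∧ IsThreadFrom G x (y :: l) := by
  rw [IsThreadFrom, IsThreadFrom, List.dropLast_cons_cons, List.getLast?_cons_cons,
    List.forall_mem_cons, List.nodup_cons (a := v), List.isChain_cons_cons (a := v),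
    List.mem_cons (b := x)]
  tauto

lemma not_isThreadFrom_nil {v : V} : ¬ IsThreadFrom G v [] := by
  rintro ⟨-, -, -, w, hw, -⟩
  simp at hw

/-- A thread is determined by its first vertex: at a vertex of degree 2 there is only one way to go
on. -/
lemma IsThreadFrom.eq {v x : V} {l l' : List V} (h : IsThreadFrom G v (x :: l))
    (h' : IsThreadFrom G v (x :: l')) : l = l' := by
  induction l generalizing v x l' with
  | nil =>
    cases l' with
    | nil => rfl
    | cons y l' =>
      have h1 := (isThreadFrom_singleton h).2
      have h2 := (isThreadFrom_cons_cons.1 h').2.2.2.1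
      omega
  | cons y l ih =>
    cases l' with
    | nil =>
      have h1 := (isThreadFrom_singleton h').2
      have h2 := (isThreadFrom_cons_cons.1 h).2.2.2.1
      omega
    | cons z l' =>
      obtain ⟨-, hv, hadj, hd, hl⟩ := isThreadFrom_cons_cons.1 h
      obtain ⟨-, hv', -, -, hl'⟩ := isThreadFrom_cons_cons.1 h'
      have hy : G.Adj x y := (List.isChain_cons_cons.1 hl.2.1).1
      have hz : G.Adj x z := (List.isChain_cons_cons.1 hl'.2.1).1
      have : y = z := by
        by_contra hne
        have := three_le_degree hadj.symm hy hz (fun h => hv (h ▸ List.mem_cons_self))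
          (fun h => hv' (h ▸ List.mem_cons_self)) hne
        omega
      subst this
      rw [ih hl hl']

namespace Rooting

variable (R : Rooting G)

lemma two_le_degree (R : Rooting G) {c : V} (hc : c ∈ cycleVerts G) : 2 ≤ G.degree c := by
  classical
  obtain ⟨u, w, -, -, hne, hu, hw, -⟩ := exists_cycle_neighbors R hc
  have := card_le_degree (G := G) (v := c) {u, w} (by simp [hu, hw])
  rwa [Finset.card_pair hne] at this

lemma three_le_degree_cycle {c y : V} (hc : c ∈ cycleVerts G) (hy : y ∉ cycleVerts G)
    (hyc : R.par y = c) : 3 ≤ G.degree c := by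
  obtain ⟨u, w, huC, hwC, hne, hu, hw, -⟩ := exists_cycle_neighbors R hc
  have h := R.adj_par y hy
  rw [hyc] at h
  exact three_le_degree hu hw h.symm hne (fun h => hy (h ▸ huC)) (fun h => hy (h ▸ hwC))

lemma four_le_degree_cycle {c x y : V} (hc : c ∈ cycleVerts G) (hx : x ∉ cycleVerts G)
    (hxc : R.par x = c) (hy : y ∉ cycleVerts G)
    (hyc : R.par y = c) (hxy : x ≠ y) : 4 ≤ G.degree c := by
  classical
  obtain ⟨u, w, huC, hwC, hne, hu, hw, -⟩ := exists_cycle_neighbors R hc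
  have h := R.adj_par y hy
  have h' := R.adj_par x hx
  rw [hyc] at h
  rw [hxc] at h'
  have := card_le_degree (G := G) (v := c) {u, w, x, y} (by simp [hu, hw, h.symm, h'.symm])
  rwa [Finset.card_insert_of_notMem, Finset.card_eq_three.2 ⟨w, x, y, ?_, ?_, hxy, rfl⟩] at this
  · rintro rfl; exact hx hwC
  · rintro rfl; exact hy hwC
  · simp only [Finset.mem_insert, Finset.mem_singleton, not_or]
    exact ⟨hne, fun h => hx (h ▸ huC), fun h => hy (h ▸ huC)⟩

lemma three_le_degree_of_children {v x y : V} (hx : x ∉ cycleVerts G) (hxv : R.par x = v)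
    (hy : y ∉ cycleVerts G) (hyv : R.par y = v) (hxy : x ≠ y) : 3 ≤ G.degree v := by
  by_cases hv : v ∈ cycleVerts G
  · exact R.three_le_degree_cycle hv hx hxv
  · have h1 := R.adj_par v hv
    have h2 := R.adj_par x hx
    have h3 := R.adj_par y hy
    rw [hxv] at h2
    rw [hyv] at h3
    exact three_le_degree h1 h2.symm h3.symm (R.par_ne_child hv hx hxv) (R.par_ne_child hv hy hyv)
      hxy

/-- The vertex `x` is the first vertex of a path hanging at `par x`. -/
def IsThreadTop (x : V) : Prop := x ∉ cycleVerts G ∧ ∀ y ∈ R.desc x, G.degree y ≤ 2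

lemma IsThreadTop.of_mem_desc {R : Rooting G} {x y : V} (h : R.IsThreadTop x)
    (hy : y ∈ R.desc x) : R.IsThreadTop y :=
  ⟨R.notMem_cycle_of_mem_desc h.1 hy, fun _ hz => h.2 _ (R.desc_trans hz hy)⟩

/-- Turns lists into subtrees. The end of the thread is a leaf, hence off the cycle, and the degree
conditions propagate the parent relation back to `v`. -/
lemma isThreadFrom_desc {v x : V} {l : List V} (h : IsThreadFrom G v (x :: l)) :
    x ∉ cycleVerts G ∧ R.par x = v ∧ ∀ y, y ∈ R.desc x ↔ y ∈ x :: l := by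
  induction l generalizing v x with
  | nil =>
    obtain ⟨hadj, hd⟩ := isThreadFrom_singleton h
    have hx : x ∉ cycleVerts G := fun hx => by
      have := R.two_le_degree hx
      omega
    obtain ⟨w, hw, huniq⟩ := degree_eq_one_iff_existsUnique_adj.1 hd
    have hv := huniq v hadj.symm
    have hp := huniq _ (R.adj_par x hx)
    refine ⟨hx, hp.trans hv.symm, fun y => ?_⟩
    rw [R.mem_desc_iff]
    simp only [List.mem_singleton]
    refine ⟨?_, Or.inl⟩
    rintro (h | ⟨z, hz, hzx, -⟩)
    · exact h
    · have hzz := huniq z (hzx ▸ (R.adj_par z hz).symm)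
      exact absurd (hp.trans hzz.symm) (R.par_ne_child hx hz hzx)
  | cons y l ih =>
    obtain ⟨hvx, hv, hadj, hd, hl⟩ := isThreadFrom_cons_cons.1 h
    obtain ⟨hy, hyx, hdesc⟩ := ih hl
    have hvy : v ≠ y := fun h => hv (h ▸ List.mem_cons_self)
    have hady : G.Adj x y := hyx ▸ (R.adj_par y hy).symm
    have hx : x ∉ cycleVerts G := fun hx => by
      have := R.three_le_degree_cycle hx hy hyx
      omega
    have huniq : ∀ z, G.Adj x z → z = v ∨ z = y := by
      intro z hz
      by_contra! hne
      have := three_le_degree hadj.symm hady hz hvy hne.1.symm hne.2.symm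
      omega
    have hp : R.par x = v :=
      (huniq _ (R.adj_par x hx)).resolve_right (R.par_ne_child hx hy hyx)
    refine ⟨hx, hp, fun z => ?_⟩
    rw [R.mem_desc_iff, List.mem_cons, ← hdesc]
    refine or_congr_right ⟨?_, fun h => ⟨y, hy, hyx, h⟩⟩
    rintro ⟨w, hw, hwx, hz⟩
    rcases huniq w (hwx ▸ (R.adj_par w hw).symm) with rfl | rfl
    · exact absurd hp (R.par_ne_child hx hw hwx)
    · exact hz

lemma isThreadTop_of_isThreadFrom {v x : V} {l : List V} (h : IsThreadFrom G v (x :: l)) :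
    R.IsThreadTop x := by
  obtain ⟨hx, -, hd⟩ := R.isThreadFrom_desc h
  refine ⟨hx, fun y hy => ?_⟩
  obtain ⟨-, -, h2, w, hw, hw1⟩ := h
  rw [hd, ← List.dropLast_append_getLast? w hw, List.mem_append, List.mem_singleton] at hy
  rcases hy with hv | rfl
  · have := h2 y hv; omega
  · omega

/-- Converse of `isThreadTop_of_isThreadFrom`: with degrees at most 2 each vertex has at most one
child, so the subtree unrolls into a list. -/
lemma exists_isThreadFrom (x : V) (hx : x ∉ cycleVerts G) :
    R.IsThreadTop x → ∃ l, IsThreadFrom G (R.par x) (x :: l) := by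
  classical
  refine R.desc_induction (P := fun x => R.IsThreadTop x →
    ∃ l, IsThreadFrom G (R.par x) (x :: l)) ?_ x hx
  clear hx x
  intro x hx ih ht
  have hadj := R.adj_par x hx
  have hd2 := ht.2 x (R.self_mem_desc x)
  by_cases hy : ∃ y, y ∉ cycleVerts G ∧ R.par y = x
  · obtain ⟨y, hy, rfl⟩ := hy
    have hty := ht.of_mem_desc (R.mem_desc_par y)
    obtain ⟨l, hl⟩ := ih y hy rfl hty
    obtain ⟨-, -, hdesc⟩ := R.isThreadFrom_desc hl
    refine ⟨y :: l, isThreadFrom_cons_cons.2 ⟨hadj.ne', fun hmem => ?_, hadj.symm, ?_, hl⟩⟩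
    · rw [← hdesc] at hmem
      exact R.par_notMem_desc hx (R.desc_trans hmem (R.mem_desc_par y))
    · have := card_le_degree (G := G) (v := R.par y) {R.par (R.par y), y}
        (by simp [hadj, (R.adj_par y hy).symm])
      rw [Finset.card_pair (R.par_ne_child hx hy rfl)] at this
      omega
  · refine ⟨[], ?_, ?_, by simp, x, rfl, ?_⟩
    · simp [hadj.ne']
    · simp [hadj.symm]
    · rw [degree_eq_one_iff_existsUnique_adj]
      refine ⟨R.par x, hadj, fun z hz => ?_⟩
      rcases R.adj_cases x z hz with h | h | h
      · exact absurd h.1 hx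
      · exact h.2.symm
      · exact absurd ⟨z, h⟩ hy

/-- The tops of the threads attached to `v`. -/
def tops (v : V) : Set V := {x | R.IsThreadTop x ∧ R.par x = v}

/-- The tops of the threads attached to `v` that contain a vertex of `S`. -/
def hitTops (S : Finset V) (v : V) : Set V := {x | x ∈ R.tops v ∧ ∃ s ∈ S, s ∈ R.desc x}

lemma exists_threadList : ∃ L : V → List V, (∀ x, R.IsThreadTop x →
    IsThreadFrom G (R.par x) (x :: L x)) := by
  have : ∀ x, ∃ l, R.IsThreadTop x → IsThreadFrom G (R.par x) (x :: l) := by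
    intro x
    by_cases h : R.IsThreadTop x
    · obtain ⟨l, hl⟩ := R.exists_isThreadFrom x h.1 h
      exact ⟨l, fun _ => hl⟩
    · exact ⟨[], fun h' => absurd h' h⟩
  choose L hL using this
  exact ⟨L, hL⟩

/-- Threads at `v` correspond bijectively to their first vertices, and meeting `S` becomes a
statement about descendants. -/
lemma threads_ncard {v : V} (hv : 3 ≤ G.degree v) (S : Finset V) :
    (threads G v).ncard = (R.tops v).ncard ∧
    {l | l ∈ threads G v ∧ ∃ x ∈ l, x ∈ S}.ncard = (R.hitTops S v).ncard := by
  obtain ⟨L, hL⟩ := R.exists_threadList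
  have hinj : Function.Injective fun x => x :: L x := fun x y h => (List.cons.inj h).1
  have key : ∀ l, l ∈ threads G v ↔ ∃ x ∈ R.tops v, x :: L x = l := by
    intro l
    rw [threads, Set.mem_ofPred_eq, isThread_iff]
    constructor
    · rintro ⟨-, h⟩
      cases l with
      | nil => exact absurd h not_isThreadFrom_nil
      | cons x l =>
        have ht := R.isThreadTop_of_isThreadFrom h
        obtain ⟨-, hp, -⟩ := R.isThreadFrom_desc h
        refine ⟨x, ⟨ht, hp⟩, ?_⟩
        have := hL x ht
        rw [hp] at this
        rw [this.eq h]
    · rintro ⟨x, ⟨ht, rfl⟩, rfl⟩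
      exact ⟨hv, hL x ht⟩
  have hmem : ∀ x ∈ R.tops v, ∀ y, y ∈ x :: L x ↔ y ∈ R.desc x :=
    fun x hx y => ((R.isThreadFrom_desc (hL x hx.1)).2.2 y).symm
  constructor
  · rw [← Set.ncard_image_of_injective _ hinj]
    congr 1
    ext l
    rw [key]; rfl
  · rw [← Set.ncard_image_of_injective _ hinj]
    congr 1
    ext l
    simp only [Set.mem_ofPred_eq, Set.mem_image, key, hitTops]
    constructor
    · rintro ⟨⟨x, hx, rfl⟩, y, hy, hyS⟩
      exact ⟨x, ⟨hx, y, hyS, (hmem x hx y).1 hy⟩, rfl⟩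
    · rintro ⟨x, ⟨hx, y, hyS, hy⟩, rfl⟩
      exact ⟨⟨x, hx, rfl⟩, y, (hmem x hx y).2 hy, hyS⟩

lemma threads_nonempty_iff {v : V} (hv : 3 ≤ G.degree v) :
    (threads G v).Nonempty ↔ (R.tops v).Nonempty := by
  obtain ⟨L, hL⟩ := R.exists_threadList
  constructor
  · rintro ⟨l, hl⟩
    rw [threads, Set.mem_ofPred_eq, isThread_iff] at hl
    cases l with
    | nil => exact absurd hl.2 not_isThreadFrom_nil
    | cons x l =>
      exact ⟨x, R.isThreadTop_of_isThreadFrom hl.2, (R.isThreadFrom_desc hl.2).2.1⟩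
  · rintro ⟨x, ht, rfl⟩
    exact ⟨_, isThread_iff.2 ⟨hv, hL x ht⟩⟩

/-- Meeting all but at most one thread means that no two threads at a vertex are both missed. Two
first vertices with a common parent already force that parent to have degree at least 3. -/
lemma isBranchResolving_iff (S : Finset V) : IsBranchResolving G S ↔
    ∀ x y, R.IsThreadTop x → R.IsThreadTop y → R.par x = R.par y → x ≠ y →
      (∃ s ∈ S, s ∈ R.desc x) ∨ ∃ s ∈ S, s ∈ R.desc y := by
  have hcard : ∀ v, 3 ≤ G.degree v → ((threads G v).ncard - 1 ≤
      {l | l ∈ threads G v ∧ ∃ x ∈ l, x ∈ S}.ncard ↔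
      (R.tops v \ R.hitTops S v).ncard ≤ 1) := by
    intro v hv
    obtain ⟨h1, h2⟩ := R.threads_ncard hv S
    have h3 := Set.ncard_sdiff_add_ncard_of_subset
      (show R.hitTops S v ⊆ R.tops v from fun x hx => hx.1) (Set.toFinite _)
    omega
  constructor
  · intro h x y hx hy hxy hne
    have h3 := R.three_le_degree_of_children hx.1 rfl hy.1 hxy.symm hne
    have h1 := (hcard _ h3).1 (h _ h3)
    by_contra! hcon
    rw [Set.ncard_le_one (Set.toFinite _)] at h1
    refine hne (h1 x ⟨⟨hx, rfl⟩, ?_⟩ y ⟨⟨hy, hxy.symm⟩, ?_⟩)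
    · rintro ⟨-, s, hs, hs'⟩; exact hcon.1 s hs hs'
    · rintro ⟨-, s, hs, hs'⟩; exact hcon.2 s hs hs'
  · intro h v hv
    rw [hcard v hv, Set.ncard_le_one (Set.toFinite _)]
    rintro x ⟨hx, hx'⟩ y ⟨hy, hy'⟩
    by_contra hne
    rcases h x y hx.1 hy.1 (hx.2.trans hy.2.symm) hne with h | h
    · exact hx' ⟨hx, h⟩
    · exact hy' ⟨hy, h⟩

end Rooting

end Degree

end Unicyclic

/-! ### Resolving sets, separation inside a tree, and minimality -/

namespace Unicyclic

variable {V : Type*} {G : SimpleGraph V}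

namespace Rooting

variable (R : Rooting G)

lemma parEdge_mem {x : V} (hx : x ∉ cycleVerts G) : s(x, R.par x) ∈ G.edgeSet := R.adj_par x hx

lemma parEdge_inj {x y : V} (hx : x ∉ cycleVerts G) (hy : y ∉ cycleVerts G)
    (h : s(x, R.par x) = s(y, R.par y)) : x = y := by
  rw [Sym2.eq_iff] at h
  rcases h with h | ⟨h1, h2⟩
  · exact h.1
  · exact absurd h2 (R.par_ne_child hx hy h1.symm)

/-- Distinct vertices of equal height in the same tree lie below distinct siblings. -/
lemma exists_siblings {x y : V} (hxy : x ≠ y) (hh : R.height x = R.height y)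
    (hr : R.root x = R.root y) : ∃ x' y', x' ∉ cycleVerts G ∧ y' ∉ cycleVerts G ∧
      x ∈ R.desc x' ∧ y ∈ R.desc y' ∧ x ∉ R.desc y' ∧ y ∉ R.desc x' ∧ x' ≠ y' ∧
      R.par x' = R.par y' := by
  classical
  -- The ancestor lines have merged at the root at the latest; the siblings sit one level below the
  -- first merging point.
  have hex : ∃ n, R.par^[n] x = R.par^[n] y := ⟨R.height x, by
    have : R.par^[R.height y] y = R.root y := rfl
    rw [hh, this, ← hr, root, hh]⟩
  obtain ⟨n, hn⟩ : ∃ n, Nat.find hex = n + 1 := by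
    apply Nat.exists_eq_succ_of_ne_zero
    intro h0
    have := Nat.find_spec hex
    rw [h0] at this
    exact hxy this
  have heq := Nat.find_spec hex
  have hne := Nat.find_min hex (m := n) (by omega)
  rw [hn, Function.iterate_succ_apply', Function.iterate_succ_apply'] at heq
  have hhe : R.height (R.par^[n] x) = R.height (R.par^[n] y) := by
    rw [height_iterate, height_iterate, hh]
  have hC : R.par^[n] x ∉ cycleVerts G := by
    intro hx
    have hy : R.par^[n] y ∈ cycleVerts G := by
      rw [← R.height_eq_zero, ← hhe, R.height_eq_zero]; exact hx
    rw [R.par_cycle _ hx, R.par_cycle _ hy] at heq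
    exact hne heq
  have hC' : R.par^[n] y ∉ cycleVerts G := by
    rw [← R.height_eq_zero, ← hhe, R.height_eq_zero]; exact hC
  exact ⟨_, _, hC, hC', ⟨n, rfl⟩, ⟨n, rfl⟩,
    fun h => hne (R.eq_of_mem_desc_of_mem_desc ⟨n, rfl⟩ h hhe hC hC'),
    fun h => hne (R.eq_of_mem_desc_of_mem_desc h ⟨n, rfl⟩ hhe hC hC'), hne, heq⟩

lemma height_lt_ncard_treeAt [Finite V] (x : V) :
    R.height x + 1 ≤ (treeAt G (R.root x)).ncard := by
  have h : ((fun n => R.par^[n] x) '' (Set.Iio (R.height x + 1))).ncard = R.height x + 1 := by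
    rw [Set.InjOn.ncard_image, ← Finset.coe_Iio, Set.ncard_coe_finset]
    · simp
    · intro i hi j hj hij
      have := congrArg R.height hij
      simp only [height_iterate, Set.mem_Iio] at this hi hj
      omega
  rw [← h]
  apply Set.ncard_le_ncard _ (Set.toFinite _)
  rintro _ ⟨n, -, rfl⟩
  rw [R.mem_treeAt_iff (R.root_mem x)]
  exact R.root_iterate n x

lemma height_le_treeLength [Finite V] (x : V) : R.height x ≤ treeLength G (R.root x) := by
  have := R.height_lt_ncard_treeAt x
  rw [treeLength]; omega

end Rooting

section Degree

variable [Fintype V] [DecidableRel G.Adj]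

namespace Rooting

variable (R : Rooting G)

/-- `S` meets at least one of any two threads attached to the same vertex. -/
def Resolves (S : Finset V) : Prop :=
  ∀ x y, R.IsThreadTop x → R.IsThreadTop y → R.par x = R.par y → x ≠ y →
      (∃ s ∈ S, s ∈ R.desc x) ∨ ∃ s ∈ S, s ∈ R.desc y

lemma resolves_iff (S : Finset V) : R.Resolves S ↔ IsBranchResolving G S :=
  (R.isBranchResolving_iff S).symm

lemma Resolves.mono {R : Rooting G} {S T : Finset V} (h : R.Resolves S) (hST : S ⊆ T) :
    R.Resolves T := by
  intro x y hx hy hxy hne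
  exact (h x y hx hy hxy hne).imp (fun ⟨s, hs, h⟩ => ⟨s, hST hs, h⟩)
    (fun ⟨s, hs, h⟩ => ⟨s, hST hs, h⟩)

/-- A missed subtree is a path: two children of one of its vertices would, by induction, start two
missed threads at the same vertex. -/
lemma Resolves.isThreadTop {R : Rooting G} {T : Finset V} (hT : R.Resolves T) {x : V}
    (hx : x ∉ cycleVerts G) : (∀ s ∈ T, s ∉ R.desc x) → R.IsThreadTop x := by
  classical
  refine R.desc_induction (P := fun x => (∀ s ∈ T, s ∉ R.desc x) → R.IsThreadTop x) ?_ x hx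
  clear hx x
  intro x hx ih hd
  have hch : ∀ y, y ∉ cycleVerts G → R.par y = x → R.IsThreadTop y := by
    rintro y hy rfl
    exact ih y hy rfl fun s hs h => hd s hs (R.desc_trans h (R.mem_desc_par y))
  have huniq : ∀ y z, y ∉ cycleVerts G → R.par y = x → z ∉ cycleVerts G → R.par z = x →
      y = z := by
    rintro y z hy rfl hz hzx
    by_contra hne
    rcases hT y z (hch y hy rfl) (hch z hz hzx) hzx.symm hne with ⟨s, hs, h⟩ | ⟨s, hs, h⟩
    · exact hd s hs (R.desc_trans h (R.mem_desc_par y))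
    · exact hd s hs (hzx ▸ R.desc_trans h (R.mem_desc_par z))
  refine ⟨hx, fun y hy => ?_⟩
  rcases R.mem_desc_iff.1 hy with rfl | ⟨z, hz, hzx, hyz⟩
  · by_cases hex : ∃ z, z ∉ cycleVerts G ∧ R.par z = y
    · obtain ⟨z, hz, hzy⟩ := hex
      refine (degree_le_card {R.par y, z} fun w hw => ?_).trans Finset.card_le_two
      rcases R.adj_cases y w hw with h | h | h
      · exact absurd h.1 hx
      · simp [h.2]
      · simp [huniq w z h.1 h.2 hz hzy]
    · refine (degree_le_card {R.par y} fun w hw => ?_).trans (by simp)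
      rcases R.adj_cases y w hw with h | h | h
      · exact absurd h.1 hx
      · simp [h.2]
      · exact absurd ⟨w, h⟩ hex
  · exact (hch z hz hzx).2 y hyz

lemma isBranching_of_children {v x y : V} (hx : x ∉ cycleVerts G) (hxv : R.par x = v)
    (hy : y ∉ cycleVerts G) (hyv : R.par y = v) (hxy : x ≠ y) : IsBranching G v := by
  by_cases hv : v ∈ cycleVerts G
  · exact Or.inl ⟨hv, R.four_le_degree_cycle hv hx hxv hy hyv hxy⟩
  · exact Or.inr ⟨hv, R.three_le_degree_of_children hx hxv hy hyv hxy⟩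

lemma exists_children_of_four_le_degree {c : V} (hc : c ∈ cycleVerts G) (hd : 4 ≤ G.degree c) :
    ∃ x y, x ∉ cycleVerts G ∧ R.par x = c ∧ y ∉ cycleVerts G ∧ R.par y = c ∧ x ≠ y := by
  classical
  obtain ⟨u, w, huC, hwC, hne, hu, hw, h2⟩ := exists_cycle_neighbors R hc
  by_contra! hcon
  have hch : ∀ z, G.Adj c z → z ∉ cycleVerts G → R.par z = c := by
    intro z hz hzC
    rcases R.adj_cases c z hz with h | h | h
    · exact absurd h.2 hzC
    · exact absurd hc h.1
    · exact h.2
  by_cases hex : ∃ z, z ∉ cycleVerts G ∧ R.par z = c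
  · obtain ⟨z, hz, hzc⟩ := hex
    have := (degree_le_card (G := G) (v := c) {u, w, z} fun t ht => ?_).trans Finset.card_le_three
    · omega
    · by_cases htC : t ∈ cycleVerts G
      · rcases h2 t htC ht with h | h <;> simp [h]
      · simp [hcon t z htC (hch t ht htC) hz hzc]
  · have := (degree_le_card (G := G) (v := c) {u, w} fun t ht => ?_).trans Finset.card_le_two
    · omega
    · by_cases htC : t ∈ cycleVerts G
      · rcases h2 t htC ht with h | h <;> simp [h]
      · exact absurd ⟨t, htC, hch t ht htC⟩ hex

/-- In an inactive tree every branch is missed and hence is a path; two branches at the root would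
be two missed threads. -/
lemma Resolves.noBranching {R : Rooting G} {T : Finset V} (hT : R.Resolves T) {c : V}
    (hc : c ∈ cycleVerts G) (hact : c ∉ activeVerts G T) : NoBranching G c := by
  have hfree : ∀ x, R.root x = c → ∀ s ∈ T, s ∉ R.desc x := by
    intro x hx s hs h
    exact hact (R.mem_activeVerts_iff.2 ⟨s, hs, (R.root_eq_of_mem_desc h).trans hx⟩)
  have htop : ∀ x, x ∉ cycleVerts G → R.root x = c → R.IsThreadTop x :=
    fun x hx hr => hT.isThreadTop hx (hfree x hr)
  intro w hw
  rw [R.mem_treeAt_iff hc] at hw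
  rintro (⟨hwC, hd⟩ | ⟨hwC, hd⟩)
  · rw [R.root_cycle hwC] at hw
    subst hw
    obtain ⟨x, y, hx, hxw, hy, hyw, hne⟩ := R.exists_children_of_four_le_degree hwC hd
    have hrx : R.root x = w := by rw [← R.root_par, hxw, R.root_cycle hwC]
    have hry : R.root y = w := by rw [← R.root_par, hyw, R.root_cycle hwC]
    rcases hT x y (htop x hx hrx) (htop y hy hry) (hxw.trans hyw.symm) hne with
      ⟨s, hs, h⟩ | ⟨s, hs, h⟩
    · exact hfree x hrx s hs h
    · exact hfree y hry s hs h
  · have := (htop w hwC hw).2 w (R.self_mem_desc w)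
    omega

/-- The first edges of two missed threads at a vertex are equally far from every element of `T`,
namely as far as that vertex. -/
lemma resolves_of_isEdgeMetricGenerator {T : Finset V} (hT : IsEdgeMetricGenerator G T) :
    R.Resolves T := by
  intro x y hx hy hxy hne
  by_contra! hcon
  obtain ⟨s, hs, h⟩ := hT _ (R.parEdge_mem hx.1) _ (R.parEdge_mem hy.1)
    (fun h => hne (R.parEdge_inj hx.1 hy.1 h))
  rw [R.edgeDist_par_of_notMem_desc hx.1 (hcon.1 s hs),
    R.edgeDist_par_of_notMem_desc hy.1 (hcon.2 s hs), hxy] at h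
  exact h rfl

/-- Edges of equal height in the same tree are distinguished by a branch-resolving set. -/
lemma Resolves.exists_edgeDist_ne {R : Rooting G} {T : Finset V} (hT : R.Resolves T) {x y : V}
    (hx : x ∉ cycleVerts G) (hy : y ∉ cycleVerts G) (hxy : x ≠ y)
    (hh : R.height x = R.height y) (hr : R.root x = R.root y) :
    ∃ s ∈ T, edgeDist G s s(x, R.par x) ≠ edgeDist G s s(y, R.par y) := by
  obtain ⟨x', y', hx', hy', hxx, hyy, hxy', hyx', hne, hpar⟩ := R.exists_siblings hxy hh hr
  -- If both sibling subtrees were missed, both would be threads at their common parent.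
  have : (∃ s ∈ T, s ∈ R.desc x') ∨ ∃ s ∈ T, s ∈ R.desc y' := by
    by_contra! hcon
    rcases hT x' y' (hT.isThreadTop hx' hcon.1) (hT.isThreadTop hy' hcon.2) hpar hne with
      ⟨s, hs, h⟩ | ⟨s, hs, h⟩
    · exact hcon.1 s hs h
    · exact hcon.2 s hs h
  rcases this with ⟨s, hs, h⟩ | ⟨s, hs, h⟩
  · refine ⟨s, hs, ?_⟩
    have h1 := R.edgeDist_le_of_mem_desc hx' h hxx
    have h2 := R.edgeDist_ge_of_separated hx' h hyx' hy
    omega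
  · refine ⟨s, hs, ?_⟩
    have h1 := R.edgeDist_le_of_mem_desc hy' h hyy
    have h2 := R.edgeDist_ge_of_separated hy' h hxy' hx
    omega

lemma height_injOn_of_noBranching {c : V} (hc : c ∈ cycleVerts G) (hb : NoBranching G c) :
    Set.InjOn R.height (treeAt G c) := by
  intro x hx y hy hh
  by_contra hne
  rw [R.mem_treeAt_iff hc] at hx hy
  obtain ⟨x', y', hx', hy', hxx, -, -, -, hne', hpar⟩ :=
    R.exists_siblings hne hh (hx.trans hy.symm)
  refine hb (R.par x') ?_ (R.isBranching_of_children hx' rfl hy' hpar.symm hne')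
  rw [R.mem_treeAt_iff hc, R.root_par, ← R.root_eq_of_mem_desc hxx, hx]

/-- Without branching, heights are injective on the tree, and ancestors fill in all smaller heights,
so a tree of length n realises every height up to n. -/
lemma exists_height_eq {c : V} (hc : c ∈ cycleVerts G) (hb : NoBranching G c) {n : ℕ}
    (hn : n ≤ treeLength G c) : ∃ x, R.root x = c ∧ R.height x = n := by
  by_contra! hcon
  have hlt : ∀ x, R.root x = c → R.height x < n := by
    intro x hx
    by_contra! h
    refine hcon (R.par^[R.height x - n] x) ((R.root_iterate _ _).trans hx) ?_
    rw [height_iterate]; omega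
  have h1 := (R.height_injOn_of_noBranching hc hb).ncard_image
  have h2 : (R.height '' treeAt G c).ncard ≤ (Set.Iio n).ncard := by
    apply Set.ncard_le_ncard _ (Set.finite_Iio n)
    rintro _ ⟨x, hx, rfl⟩
    exact hlt x ((R.mem_treeAt_iff hc).1 hx)
  rw [← Finset.coe_Iio, Set.ncard_coe_finset, Nat.card_Iio] at h2
  have h3 : 0 < (treeAt G c).ncard :=
    (Set.ncard_pos (Set.toFinite _)).2 ⟨c, (R.mem_treeAt_iff hc).2 (R.root_cycle hc)⟩
  rw [treeLength] at hn
  omega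

/-- `S` is a branch-resolving set of minimum cardinality. -/
def IsMinResolving (S : Finset V) : Prop :=
  R.Resolves S ∧ ∀ T : Finset V, R.Resolves T → S.card ≤ T.card

lemma minBranch_le_card {T : Finset V} (hT : R.Resolves T) : minBranch G ≤ T.card :=
  Nat.sInf_le ⟨T, (R.resolves_iff T).1 hT, rfl⟩

lemma isMinResolving_of_card {S : Finset V} (hS : R.Resolves S) (hc : S.card = minBranch G) :
    R.IsMinResolving S :=
  ⟨hS, fun _ hT => hc ▸ R.minBranch_le_card hT⟩

/-- In a minimum branch-resolving set every element is needed for some pair of threads. -/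
lemma IsMinResolving.exists_pair {R : Rooting G} {S : Finset V} (hS : R.IsMinResolving S) {s : V}
    (hs : s ∈ S) : ∃ x y, R.IsThreadTop x ∧ R.IsThreadTop y ∧ R.par x = R.par y ∧ x ≠ y ∧
      s ∈ R.desc x ∧ (∀ t ∈ S, t ∈ R.desc x → t = s) ∧ ∀ t ∈ S, t ∉ R.desc y := by
  classical
  by_contra! hcon
  -- If `s` were needed for no pair, it could be erased, against minimality.
  have : R.Resolves (S.erase s) := by
    have key : ∀ x y, R.IsThreadTop x → R.IsThreadTop y → R.par x = R.par y → x ≠ y →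
        (∃ t ∈ S, t ∈ R.desc x) →
        (∃ t ∈ S.erase s, t ∈ R.desc x) ∨ ∃ t ∈ S.erase s, t ∈ R.desc y := by
      rintro x y hx hy hxy hne ⟨t, ht, htx⟩
      by_cases hts : t = s
      · subst hts
        by_cases hall : ∀ t' ∈ S, t' ∈ R.desc x → t' = t
        · obtain ⟨r, hr, hry⟩ := hcon x y hx hy hxy hne htx hall
          refine Or.inr ⟨r, Finset.mem_erase.2 ⟨?_, hr⟩, hry⟩
          rintro rfl
          refine hne (R.eq_of_mem_desc_of_mem_desc htx hry ?_ hx.1 hy.1)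
          rw [R.height_par x hx.1, R.height_par y hy.1, hxy]
        · push Not at hall
          obtain ⟨t', ht', htx', hne'⟩ := hall
          exact Or.inl ⟨t', Finset.mem_erase.2 ⟨hne', ht'⟩, htx'⟩
      · exact Or.inl ⟨t, Finset.mem_erase.2 ⟨hts, ht⟩, htx⟩
    intro x y hx hy hxy hne
    rcases hS.1 x y hx hy hxy hne with h | h
    · exact key x y hx hy hxy hne h
    · exact (key y x hy hx hxy.symm hne.symm h).symm
  have h1 := hS.2 _ this
  rw [Finset.card_erase_of_mem hs] at h1
  have := Finset.card_pos.2 ⟨s, hs⟩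
  omega

lemma IsMinResolving.not_noBranching {R : Rooting G} {S : Finset V} (hS : R.IsMinResolving S)
    {c : V} (hc : c ∈ activeVerts G S) : ¬ NoBranching G c := by
  intro hb
  obtain ⟨s, hs, rfl⟩ := R.mem_activeVerts_iff.1 hc
  obtain ⟨x, y, hx, hy, hxy, hne, hsx, -⟩ := hS.exists_pair hs
  refine hb (R.par x) ?_ (R.isBranching_of_children hx.1 rfl hy.1 hxy.symm hne)
  rw [R.mem_treeAt_iff (R.root_mem _), R.root_par, R.root_eq_of_mem_desc hsx]

/-- A minimum branch-resolving set misses a thread at every cycle vertex having a thread. -/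
lemma IsMinResolving.exists_free_top {R : Rooting G} {S : Finset V} (hS : R.IsMinResolving S)
    {c x : V} (hc : c ∈ cycleVerts G) (hx : R.IsThreadTop x) (hxc : R.par x = c) :
    ∃ y, R.IsThreadTop y ∧ R.par y = c ∧ ∀ s ∈ S, s ∉ R.desc y := by
  by_contra! hcon
  obtain ⟨s, hs, hsx⟩ := hcon x hx hxc
  obtain ⟨x', y, hx', hy, hxy, hne, hsx', -, hy'⟩ := hS.exists_pair hs
  have hd := R.three_le_degree_of_children hx'.1 rfl hy.1 hxy.symm hne
  by_cases hpc : R.par x' = c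
  · obtain ⟨t, ht, hty⟩ := hcon y hy (hxy ▸ hpc)
    exact hy' t ht hty
  -- The threads at `x` and `x'` share `s` but hang at different vertices. Nesting would put either
  -- the cycle vertex `c` below `x'`, or the vertex `par x'` of degree at least 3 inside a thread.
  · rcases R.desc_comparable hsx hsx' with h | h
    · by_cases hxx : x = x'
      · exact hpc (hxx ▸ hxc)
      · have := R.par_mem_desc h hxx
        rw [hxc] at this
        exact R.cycle_notMem_desc hx'.1 hc this
    · by_cases hxx : x' = x
      · exact hpc (hxx ▸ hxc)
      · have := hx.2 _ (R.par_mem_desc h hxx)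
        omega

end Rooting

end Degree

end Unicyclic

/-! ### Arithmetic on the circle -/

namespace Unicyclic

lemma circDist_triangle {n p q r : ℕ} (hp : p < n) (hq : q < n) (hr : r < n) :
    circDist n p r ≤ circDist n p q + circDist n q r := by
  simp only [circDist]; omega

lemma circDist_comm (n p q : ℕ) : circDist n p q = circDist n q p := by
  simp only [circDist]; omega

lemma circDist_self (n p : ℕ) : circDist n p p = 0 := by simp [circDist]

lemma reflect_of_circDist_eq {n x p q : ℕ} (hx : x < n) (hp : p < n) (hq : q < n) (hpq : p ≠ q)
    (h : circDist n x p = circDist n x q) :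
    p + q = 2 * x ∨ p + q = 2 * x + n ∨ p + q + n = 2 * x := by
  simp only [circDist] at h; omega

/-- Any point lies on a geodesic between two of three points not contained in a half circle. -/
lemma exists_between {n x y z p : ℕ} (hxy : x < y) (hyz : y < z) (hz : z < n)
    (h1 : 2 * (y - x) ≤ n) (h2 : 2 * (z - y) ≤ n) (h3 : n ≤ 2 * (z - x)) (hp : p < n) :
    circDist n x p + circDist n p y = circDist n x y ∨
    circDist n y p + circDist n p z = circDist n y z ∨
    circDist n z p + circDist n p x = circDist n z x := by
  rcases le_or_gt p x with h | h
  · right; right; simp only [circDist]; omega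
  rcases le_or_gt p y with h | h
  · left; simp only [circDist]; omega
  rcases le_or_gt p z with h | h
  · right; left; simp only [circDist]; omega
  · right; right; simp only [circDist]; omega

/-- Some two of the three points, say x and y, have `p` on a geodesic between them. Then d(x,y) =
d(x,p) + d(p,y) = d(x,q) + d(q,y) + 2t, which is at least d(x,y) + 2t. -/
lemma triple_shift_nonpos {n x y z p q : ℕ} {t : ℤ} (hxy : x < y) (hyz : y < z) (hz : z < n)
    (h1 : 2 * (y - x) ≤ n) (h2 : 2 * (z - y) ≤ n) (h3 : n ≤ 2 * (z - x))
    (hp : p < n) (hq : q < n)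
    (hx : (circDist n x p : ℤ) = circDist n x q + t)
    (hy : (circDist n y p : ℤ) = circDist n y q + t)
    (hz' : (circDist n z p : ℤ) = circDist n z q + t) : t ≤ 0 := by
  have a1 := circDist_triangle (n := n) (p := x) (q := q) (r := y) (by omega) hq (by omega)
  have a2 := circDist_triangle (n := n) (p := y) (q := q) (r := z) (by omega) hq (by omega)
  have a3 := circDist_triangle (n := n) (p := z) (q := q) (r := x) (by omega) hq (by omega)
  have e := exists_between hxy hyz hz h1 h2 h3 hp
  rw [circDist_comm n q] at a1 a2 a3
  rw [circDist_comm n p, circDist_comm n p, circDist_comm n p] at e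
  omega

lemma eq_of_triple_sorted {n x y z p q : ℕ} {t : ℤ} (hxy : x < y) (hyz : y < z) (hz : z < n)
    (h1 : 2 * (y - x) ≤ n) (h2 : 2 * (z - y) ≤ n) (h3 : n ≤ 2 * (z - x))
    (hp : p < n) (hq : q < n)
    (hx : (circDist n x p : ℤ) = circDist n x q + t)
    (hy : (circDist n y p : ℤ) = circDist n y q + t)
    (hz' : (circDist n z p : ℤ) = circDist n z q + t) : p = q := by
  by_contra hne
  have t1 := triple_shift_nonpos hxy hyz hz h1 h2 h3 hp hq hx hy hz'
  have t2 := triple_shift_nonpos (t := -t) hxy hyz hz h1 h2 h3 hq hp (by omega) (by omega)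
    (by omega)
  obtain rfl : t = 0 := by omega
  -- With zero shift, `p` and `q` are mirror images in the axes through x, y and z. Then 2x, 2y, 2z
  -- agree modulo n, which fails for three distinct points.
  have b1 := reflect_of_circDist_eq (by omega) hp hq hne (by omega : circDist n x p = _)
  have b2 := reflect_of_circDist_eq (by omega) hp hq hne (by omega : circDist n y p = _)
  have b3 := reflect_of_circDist_eq (by omega) hp hq hne (by omega : circDist n z p = _)
  omega

/-- Three points not contained in a half circle separate points, even up to an additive shift. -/
lemma eq_of_triple {n x y z p q : ℕ} {t : ℤ} (hx : x < n) (hy : y < n) (hz : z < n)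
    (hxy : x ≠ y) (hyz : y ≠ z) (hzx : z ≠ x)
    (hsum : circDist n x y + circDist n y z + circDist n z x = n) (hp : p < n) (hq : q < n)
    (ex : (circDist n x p : ℤ) = circDist n x q + t)
    (ey : (circDist n y p : ℤ) = circDist n y q + t)
    (ez : (circDist n z p : ℤ) = circDist n z q + t) : p = q := by
  have key : ∀ u v w : ℕ, u < v → v < w → w < n →
      circDist n u v + circDist n v w + circDist n w u = n →
      2 * (v - u) ≤ n ∧ 2 * (w - v) ≤ n ∧ n ≤ 2 * (w - u) := by
    intro u v w huv hvw hw h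
    simp only [circDist] at h
    omega
  have c1 := circDist_comm n x y
  have c2 := circDist_comm n y z
  have c3 := circDist_comm n z x
  rcases lt_or_gt_of_ne hxy with h | h <;> rcases lt_or_gt_of_ne hyz with h' | h' <;>
    rcases lt_or_gt_of_ne hzx with h'' | h''
  · omega
  · obtain ⟨k1, k2, k3⟩ := key x y z h h' hz (by omega)
    exact eq_of_triple_sorted h h' hz k1 k2 k3 hp hq ex ey ez
  · obtain ⟨k1, k2, k3⟩ := key z x y h'' h hy (by omega)
    exact eq_of_triple_sorted h'' h hy k1 k2 k3 hp hq ez ex ey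
  · obtain ⟨k1, k2, k3⟩ := key x z y h'' h' hy (by omega)
    exact eq_of_triple_sorted h'' h' hy k1 k2 k3 hp hq ex ez ey
  · obtain ⟨k1, k2, k3⟩ := key y z x h' h'' hx (by omega)
    exact eq_of_triple_sorted h' h'' hx k1 k2 k3 hp hq ey ez ex
  · obtain ⟨k1, k2, k3⟩ := key y x z h h'' hz (by omega)
    exact eq_of_triple_sorted h h'' hz k1 k2 k3 hp hq ey ex ez
  · obtain ⟨k1, k2, k3⟩ := key z y x h' h hx (by omega)
    exact eq_of_triple_sorted h' h hx k1 k2 k3 hp hq ez ey ex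
  · omega

lemma circDist_cases {l r p : ℕ} (hr : r < l) (hp : p < 2 * l) :
    (p < r ∧ (circDist (2 * l) r p : ℤ) = r - p) ∨
    (r ≤ p ∧ p ≤ l + r ∧ (circDist (2 * l) r p : ℤ) = p - r) ∨
    (l + r < p ∧ (circDist (2 * l) r p : ℤ) = 2 * l + r - p) := by
  rcases lt_or_ge p r with h | h
  · left
    refine ⟨h, ?_⟩
    simp only [circDist]; omega
  rcases le_or_gt p (l + r) with h' | h'
  · right; left
    refine ⟨h, h', ?_⟩
    simp only [circDist]; omega
  · right; right
    refine ⟨h', ?_⟩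
    simp only [circDist]; omega

/-- The pairs of positions on a circle of length `2 * l` which are not separated, up to a shift
`t`, by the points `0` and `J`. -/
lemma positions_of_two {l J p q : ℕ} {t : ℤ} (hJ : 0 < J) (hJl : J < l) (hp : p < 2 * l)
    (hq : q < 2 * l) (hpq : p ≠ q) (ht : 0 ≤ t)
    (h0 : (circDist (2 * l) 0 p : ℤ) + t = circDist (2 * l) 0 q)
    (h1 : (circDist (2 * l) J p : ℤ) + t = circDist (2 * l) J q) :
    (J ≤ p ∧ p < q ∧ q ≤ l ∧ t = q - p) ∨
    (p = 0 ∧ l + J ≤ q ∧ t = 2 * l - q) ∨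
    (q < p ∧ l + J ≤ q ∧ t = p - q) ∨
    (0 < p ∧ p < J ∧ q + p = l + J ∧ t = l - J) := by
  rcases circDist_cases (r := 0) (by omega) hp with ⟨a1, e1⟩ | ⟨-, a1, e1⟩ | ⟨a1, e1⟩
  · omega
  all_goals
    rcases circDist_cases hJl hp with ⟨a2, e2⟩ | ⟨a2, a3, e2⟩ | ⟨a2, e2⟩
  all_goals try omega
  all_goals
    rcases circDist_cases (r := 0) (by omega) hq with ⟨b1, f1⟩ | ⟨-, b1, f1⟩ | ⟨b1, f1⟩
  all_goals try omega
  all_goals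
    rw [e1, f1] at h0
    rcases circDist_cases hJl hq with ⟨b2, f2⟩ | ⟨b2, b3, f2⟩ | ⟨b2, f2⟩
  all_goals rw [e2, f2] at h1; clear e1 e2 f1 f2; push_cast at h0
  all_goals first
    | (exfalso; clear hpq; omega)
    | (exfalso; omega)
    | exact Or.inr (Or.inl ⟨by omega, by omega, by omega⟩)
    | exact Or.inr (Or.inr (Or.inl ⟨by omega, by omega, by omega⟩))
    | skip
  rcases Nat.eq_zero_or_pos p with h | h
  · exact Or.inr (Or.inl ⟨h, by omega, by omega⟩)
  · exact Or.inr (Or.inr (Or.inr ⟨h, by omega, by omega, by omega⟩))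

/-- A third observation point strictly inside the arc destroys the fourth configuration of
`positions_of_two`. -/
lemma not_third {l J K p q : ℕ} (hK : 0 < K) (hKJ : K < J) (hJl : J < l) (hp : 0 < p)
    (hpJ : p < J) (hq : q + p = l + J) :
    (circDist (2 * l) K p : ℤ) + (l - J) ≠ circDist (2 * l) K q := by
  simp only [circDist]; omega

end Unicyclic

/-! ### Edges as points with height over the circle of doubled length -/

namespace Unicyclic

variable {V : Type*} {G : SimpleGraph V}

namespace Rooting

variable (R : Rooting G)

/-- The index of the root of `v` with respect to a labelling. -/
noncomputable def pos (a : ℕ → V) (v : V) : ℕ := cycleIdx G a (R.root v)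

/-- The edge `e` lies at position `p`, at (doubled) height `t`, on the circle of length `2ℓ`: the
vertex `a i` of the cycle has position `2i`, and the midpoint of the edge following it `2i + 1`. -/
def EdgeAt (a : ℕ → V) (e : Sym2 V) (p : ℕ) (t : ℤ) : Prop :=
  (∃ i < cycleLength G, e = s(a i, a ((i + 1) % cycleLength G)) ∧ p = 2 * i + 1 ∧ t = -1) ∨
  ∃ x, x ∉ cycleVerts G ∧ e = s(x, R.par x) ∧ p = 2 * R.pos a x ∧ t = 2 * R.height x - 2

variable {a : ℕ → V}

lemma pos_lt (ha : IsCycleLabelling G a) (v : V) : R.pos a v < cycleLength G :=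
  ha.cycleIdx_lt (R.root_mem v)

lemma apply_pos (ha : IsCycleLabelling G a) (v : V) : a (R.pos a v) = R.root v :=
  ha.apply_cycleIdx (R.root_mem v)

lemma pos_eq_iff (ha : IsCycleLabelling G a) {v : V} {i : ℕ} (hi : i < cycleLength G) :
    R.pos a v = i ↔ R.root v = a i := by
  constructor
  · rintro rfl
    exact (R.apply_pos ha v).symm
  · intro h
    rw [pos, h, ha.cycleIdx_apply hi]

lemma pos_eq_pos_iff (ha : IsCycleLabelling G a) {u v : V} :
    R.pos a u = R.pos a v ↔ R.root u = R.root v := by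
  rw [R.pos_eq_iff ha (R.pos_lt ha v), R.apply_pos ha]

lemma dist_root (ha : IsCycleLabelling G a) (u v : V) :
    G.dist (R.root u) (R.root v) = circDist (cycleLength G) (R.pos a u) (R.pos a v) := by
  rw [← R.apply_pos ha u, ← R.apply_pos ha v, ha.dist_eq R (R.pos_lt ha u) (R.pos_lt ha v)]

lemma exists_edgeAt (ha : IsCycleLabelling G a) {e : Sym2 V} (he : e ∈ G.edgeSet) :
    ∃ p t, R.EdgeAt a e p t := by
  induction e with | _ x y
  rw [mem_edgeSet] at he
  rcases R.adj_cases x y he with h | ⟨h, rfl⟩ | ⟨h, rfl⟩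
  · obtain ⟨i, hi, h⟩ := R.adj_labelling a ha x y he h.1 h.2
    exact ⟨_, _, Or.inl ⟨i, hi, h, rfl, rfl⟩⟩
  · exact ⟨_, _, Or.inr ⟨x, h, rfl, rfl, rfl⟩⟩
  · exact ⟨_, _, Or.inr ⟨y, h, Sym2.eq_swap, rfl, rfl⟩⟩

lemma circDist_two_mul {n p q : ℕ} : circDist (2 * n) (2 * p) (2 * q) = 2 * circDist n p q := by
  simp only [circDist]; omega

/-- On the doubled circle the midpoint of a cycle edge is 1 farther than its nearer endpoint; this
is why cycle edges get doubled height -1 in `EdgeAt`. -/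
lemma min_circDist {n p i : ℕ} (hp : p < n) (hi : i < n) :
    2 * min (circDist n p i) (circDist n p ((i + 1) % n)) + 1 =
      circDist (2 * n) (2 * p) (2 * i + 1) := by
  rw [succ_mod hi]
  split_ifs with h
  · subst h; simp only [circDist]; omega
  · simp only [circDist]
    rcases le_or_gt p i with h' | h' <;> omega

namespace EdgeAt

variable {R} {e f : Sym2 V} {p q : ℕ} {t u : ℤ}

lemma lt (ha : IsCycleLabelling G a) (he : R.EdgeAt a e p t) : p < 2 * cycleLength G := by
  rcases he with ⟨i, hi, -, rfl, -⟩ | ⟨x, -, -, rfl, -⟩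
  · omega
  · have := R.pos_lt ha x; omega

lemma edgeDist_cycle (ha : IsCycleLabelling G a) (s : V) {i : ℕ} (hi : i < cycleLength G) :
    2 * (edgeDist G s s(a i, a ((i + 1) % cycleLength G)) : ℤ) = 2 * R.height s +
      circDist (2 * cycleLength G) (2 * R.pos a s) (2 * i + 1) - 1 := by
  have hi' : (i + 1) % cycleLength G < cycleLength G := Nat.mod_lt _ (by omega)
  rw [R.edgeDist_cycle s (ha.mem hi) (ha.mem hi'), ← R.apply_pos ha s,
    ha.dist_eq R (R.pos_lt ha s) hi, ha.dist_eq R (R.pos_lt ha s) hi',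
    ← min_circDist (R.pos_lt ha s) hi]
  push_cast
  ring

lemma edgeDist_le (ha : IsCycleLabelling G a) (he : R.EdgeAt a e p t) (s : V) :
    2 * (edgeDist G s e : ℤ) ≤
      2 * R.height s + circDist (2 * cycleLength G) (2 * R.pos a s) p + t := by
  rcases he with ⟨i, hi, rfl, rfl, rfl⟩ | ⟨x, hx, rfl, rfl, rfl⟩
  · rw [edgeDist_cycle (R := R) ha s hi]; omega
  · have := R.edgeDist_par_le s hx
    rw [R.dist_root ha] at this
    rw [circDist_two_mul]
    push_cast
    omega

lemma edgeDist_eq (ha : IsCycleLabelling G a) (he : R.EdgeAt a e p t) {s : V}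
    (hs : p ≠ 2 * R.pos a s) : 2 * (edgeDist G s e : ℤ) =
      2 * R.height s + circDist (2 * cycleLength G) (2 * R.pos a s) p + t := by
  rcases he with ⟨i, hi, rfl, rfl, rfl⟩ | ⟨x, hx, rfl, rfl, rfl⟩
  · rw [edgeDist_cycle (R := R) ha s hi]; omega
  · have := R.edgeDist_par_eq (s := s) hx (fun h => hs (by rw [(R.pos_eq_pos_iff ha).2 h]))
    rw [R.dist_root ha] at this
    rw [circDist_two_mul]
    push_cast
    omega

/-- If two vertices with different roots do not distinguish two edges at different positions, then
all their distances to these edges are attained through the roots. -/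
lemma edgeDist_eq_of_not_distinguished (ha : IsCycleLabelling G a) (he : R.EdgeAt a e p t)
    (hf : R.EdgeAt a f q u) (hpq : p ≠ q) {s s' : V} (hss : R.pos a s ≠ R.pos a s')
    (hs : edgeDist G s e = edgeDist G s f) (hs' : edgeDist G s' e = edgeDist G s' f) :
    2 * (edgeDist G s e : ℤ) =
      2 * R.height s + circDist (2 * cycleLength G) (2 * R.pos a s) p + t := by
  by_cases h : p = 2 * R.pos a s
  · have h1 := he.edgeDist_le ha s
    have h2 := hf.edgeDist_eq ha (s := s) (by omega)
    have h3 := he.edgeDist_eq ha (s := s') (by omega)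
    have h4 := hf.edgeDist_le ha s'
    have h5 := R.pos_lt ha s
    have h6 := R.pos_lt ha s'
    -- Here `s` sits at the position of `e`, so its distance is only bounded above. The exact
    -- distances of `s` to `f` and of `s'` to `e`, together with the triangle inequality through
    -- `p`, force equality.
    have h7 := circDist_triangle (n := 2 * cycleLength G) (p := 2 * R.pos a s') (q := p) (r := q)
      (by omega) (he.lt ha) (hf.lt ha)
    rw [← h, circDist_self] at h1
    rw [← h] at h2
    rw [← h, circDist_self]
    omega
  · exact he.edgeDist_eq ha h

end EdgeAt

section Active

variable {R}

lemma exists_pos_of_active (ha : IsCycleLabelling G a) {T : Finset V} {i : ℕ}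
    (hi : i < cycleLength G) (h : a i ∈ activeVerts G T) : ∃ s ∈ T, R.pos a s = i := by
  obtain ⟨s, hs, hsi⟩ := R.mem_activeVerts_iff.1 h
  exact ⟨s, hs, (R.pos_eq_iff ha hi).2 hsi⟩

lemma active_of_mem (ha : IsCycleLabelling G a) {T : Finset V} {s : V} (hs : s ∈ T) :
    a (R.pos a s) ∈ activeVerts G T :=
  R.mem_activeVerts_iff.2 ⟨s, hs, (R.apply_pos ha s).symm⟩

end Active

end Rooting

section Degree

variable [Fintype V] [DecidableRel G.Adj]

namespace Rooting

variable {R : Rooting G} {a : ℕ → V}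

/-- Parity of the position separates cycle edges from tree edges. For two edges of one tree, a
vertex of another tree reads off the height, and edges of equal height are separated by resolving.
-/
lemma EdgeAt.eq_of_not_distinguished (ha : IsCycleLabelling G a) {T : Finset V}
    (hT : R.Resolves T) (h2 : ∀ i, ∃ s ∈ T, R.pos a s ≠ i) {e f : Sym2 V} {p : ℕ} {t u : ℤ}
    (he : R.EdgeAt a e p t) (hf : R.EdgeAt a f p u)
    (h : ∀ s ∈ T, edgeDist G s e = edgeDist G s f) : e = f := by
  rcases he with ⟨i, hi, rfl, rfl, rfl⟩ | ⟨x, hx, rfl, rfl, rfl⟩ <;>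
  rcases hf with ⟨j, hj, rfl, hp, rfl⟩ | ⟨y, hy, rfl, hp, rfl⟩
  · obtain rfl : i = j := by omega
    rfl
  · omega
  · omega
  · by_contra hne
    have hxy : x ≠ y := fun h => hne (by rw [h])
    have hpos : R.pos a x = R.pos a y := by omega
    have hr := (R.pos_eq_pos_iff ha).1 hpos
    have hh : R.height x = R.height y := by
      obtain ⟨s, hs, hsp⟩ := h2 (R.pos a x)
      have h1 := R.edgeDist_par_eq (s := s) hx fun h => hsp ((R.pos_eq_pos_iff ha).2 h)
      have h2 := R.edgeDist_par_eq (s := s) hy fun h =>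
        hsp ((R.pos_eq_pos_iff ha).2 (h.trans hr.symm))
      have h3 := h s hs
      rw [hr] at h1
      omega
    obtain ⟨s, hs, hne⟩ := hT.exists_edgeDist_ne hx hy hxy hh hr
    exact hne (h s hs)

/-- Criterion for a branch-resolving set to be an edge metric generator. -/
lemma Resolves.isEdgeMetricGenerator (ha : IsCycleLabelling G a) {T : Finset V}
    (hT : R.Resolves T) (h2 : ∀ i, ∃ s ∈ T, R.pos a s ≠ i)
    (h : ∀ e f p q t u, R.EdgeAt a e p t → R.EdgeAt a f q u → p ≠ q → u ≤ t →
      (∀ s ∈ T, 2 * (edgeDist G s e : ℤ) =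
        2 * R.height s + circDist (2 * cycleLength G) (2 * R.pos a s) p + t) →
      (∀ s ∈ T, (circDist (2 * cycleLength G) (2 * R.pos a s) p : ℤ) + t =
        circDist (2 * cycleLength G) (2 * R.pos a s) q + u) → False) :
    IsEdgeMetricGenerator G T := by
  intro e he f hf hef
  by_contra! hcon
  obtain ⟨p, t, hp⟩ := R.exists_edgeAt ha he
  obtain ⟨q, u, hq⟩ := R.exists_edgeAt ha hf
  by_cases hpq : p = q
  · subst hpq
    exact hef (hp.eq_of_not_distinguished ha hT h2 hq hcon)
  have h1 : ∀ s ∈ T, 2 * (edgeDist G s e : ℤ) =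
      2 * R.height s + circDist (2 * cycleLength G) (2 * R.pos a s) p + t := by
    intro s hs
    obtain ⟨s', hs', hne⟩ := h2 (R.pos a s)
    exact hp.edgeDist_eq_of_not_distinguished ha hq hpq hne.symm (hcon s hs) (hcon s' hs')
  have h3 : ∀ s ∈ T, 2 * (edgeDist G s f : ℤ) =
      2 * R.height s + circDist (2 * cycleLength G) (2 * R.pos a s) q + u := by
    intro s hs
    obtain ⟨s', hs', hne⟩ := h2 (R.pos a s)
    exact hq.edgeDist_eq_of_not_distinguished ha hp (Ne.symm hpq) hne.symm (hcon s hs).symm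
      (hcon s' hs').symm
  have h4 : ∀ s ∈ T, (circDist (2 * cycleLength G) (2 * R.pos a s) p : ℤ) + t =
        circDist (2 * cycleLength G) (2 * R.pos a s) q + u := by
    intro s hs
    have e1 := h1 s hs
    have e2 := h3 s hs
    rw [hcon s hs] at e1
    omega
  rcases le_total u t with htu | htu
  · exact h e f p q t u hp hq hpq htu h1 h4
  · exact h f e q p u t hq hp (Ne.symm hpq) htu h3 fun s hs => (h4 s hs).symm

/-- A branch-resolving set with a geodesic triple of active vertices is an edge metric
generator. -/
theorem Resolves.isEdgeMetricGenerator_of_triple {T : Finset V}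
    (hT : R.Resolves T) {x y z : V} (hx : x ∈ activeVerts G T) (hy : y ∈ activeVerts G T)
    (hz : z ∈ activeVerts G T) (h : IsGeodesicTriple G x y z) : IsEdgeMetricGenerator G T := by
  obtain ⟨a, ha⟩ := R.exists_labelling
  obtain ⟨hxC, hyC, hzC, hxy, hyz, hzx, hsum⟩ := h
  obtain ⟨r1, hs1, rfl⟩ := R.mem_activeVerts_iff.1 hx
  obtain ⟨r2, hs2, rfl⟩ := R.mem_activeVerts_iff.1 hy
  obtain ⟨r3, hs3, rfl⟩ := R.mem_activeVerts_iff.1 hz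
  rw [R.dist_root ha, R.dist_root ha, R.dist_root ha] at hsum
  rw [Ne, ← R.pos_eq_pos_iff ha] at hxy hyz hzx
  have l1 := R.pos_lt ha r1
  have l2 := R.pos_lt ha r2
  have l3 := R.pos_lt ha r3
  refine hT.isEdgeMetricGenerator ha (fun i => ?_) ?_
  · by_cases h1 : R.pos a r1 = i
    · exact ⟨r2, hs2, by omega⟩
    · exact ⟨r1, hs1, h1⟩
  · intro e f p q t u he hf hpq _ _ h4
    have e1 := h4 r1 hs1
    have e2 := h4 r2 hs2
    have e3 := h4 r3 hs3
    refine hpq (eq_of_triple (n := 2 * cycleLength G) (x := 2 * R.pos a r1)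
      (y := 2 * R.pos a r2) (z := 2 * R.pos a r3) (t := u - t) (by omega) (by omega) (by omega)
      (by omega) (by omega) (by omega) ?_ (he.lt ha) (hf.lt ha) (by omega) (by omega) (by omega))
    rw [circDist_two_mul, circDist_two_mul, circDist_two_mul]
    omega

end Rooting

end Degree

end Unicyclic

/-! ### Sufficiency and necessity of the odd and even conditions -/

namespace Unicyclic

variable {V : Type*} {G : SimpleGraph V}

namespace Rooting

variable {R : Rooting G} {a : ℕ → V}

/-- When every branch at `a k` meets `T`, an element in the branch of the edge reaches it without
going down to the cycle, strictly faster than the formula through the root. -/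
lemma no_edge_at_hit (ha : IsCycleLabelling G a) {T : Finset V} {k : ℕ} (hk : k < cycleLength G)
    (hhit : ∀ x, x ∉ cycleVerts G → R.par x = a k → ∃ s ∈ T, s ∈ R.desc x) {x : V}
    (hx : x ∉ cycleVerts G) (hxk : R.pos a x = k)
    (h : ∀ s ∈ T, 2 * (edgeDist G s s(x, R.par x) : ℤ) = 2 * R.height s +
      circDist (2 * cycleLength G) (2 * R.pos a s) (2 * R.pos a x) + (2 * R.height x - 2)) :
    False := by
  obtain ⟨x', hx', hxx, hpar⟩ := R.exists_top hx
  rw [(R.pos_eq_iff ha hk).1 hxk] at hpar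
  obtain ⟨s, hs, hsx⟩ := hhit x' hx' hpar
  have h1 := h s hs
  have h2 := R.edgeDist_le_of_mem_desc hx' hsx hxx
  have h3 : R.pos a s = R.pos a x := (R.pos_eq_pos_iff ha).2
    ((R.root_eq_of_mem_desc hsx).trans (R.root_eq_of_mem_desc hxx).symm)
  rw [h3, circDist_self] at h1
  have h4 := R.height_pos hx'
  omega

lemma exists_pos_ne_of_isEdgeMetricGenerator (ha : IsCycleLabelling G a) {T : Finset V}
    (hT : IsEdgeMetricGenerator G T) {e f : Sym2 V} (he : e ∈ G.edgeSet) (hf : f ∈ G.edgeSet)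
    (hef : e ≠ f) {p q : ℕ} {t u : ℤ} (hep : R.EdgeAt a e p t) (hfq : R.EdgeAt a f q u)
    (hp : ∀ s ∈ T, p ≠ 2 * R.pos a s) (hq : ∀ s ∈ T, q ≠ 2 * R.pos a s) :
    ∃ s ∈ T, (circDist (2 * cycleLength G) (2 * R.pos a s) p : ℤ) + t ≠
        circDist (2 * cycleLength G) (2 * R.pos a s) q + u := by
  obtain ⟨s, hs, h⟩ := hT e he f hf hef
  refine ⟨s, hs, fun hc => h ?_⟩
  have h1 := hep.edgeDist_eq ha (hp s hs)
  have h2 := hfq.edgeDist_eq ha (hq s hs)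
  omega

lemma cycleEdge_mem (ha : IsCycleLabelling G a) {i : ℕ} (hi : i < cycleLength G) :
    s(a i, a ((i + 1) % cycleLength G)) ∈ G.edgeSet := ha.2 i hi

lemma parEdge_ne_cycleEdge (ha : IsCycleLabelling G a) {i : ℕ} (hi : i < cycleLength G) {x : V}
    (hx : x ∉ cycleVerts G) : s(x, R.par x) ≠ s(a i, a ((i + 1) % cycleLength G)) := by
  intro h
  have : x ∈ s(a i, a ((i + 1) % cycleLength G)) := h ▸ Sym2.mem_mk_left _ _
  rcases Sym2.mem_iff.1 this with h | h
  · exact hx (h ▸ ha.mem hi)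
  · exact hx (h ▸ ha.mem (Nat.mod_lt _ (by omega)))

/-- An edge metric generator distinguishes a cycle edge from an edge leaving the cycle. -/
lemma exists_circDist_ne (ha : IsCycleLabelling G a) {T : Finset V}
    (hT : IsEdgeMetricGenerator G T) {x : V} {i k : ℕ} (hi : i < cycleLength G)
    (hk : k < cycleLength G) (hx : x ∉ cycleVerts G) (hxk : R.par x = a k)
    (hfree : ∀ s ∈ T, s ∉ R.desc x) : ∃ s ∈ T,
      circDist (2 * cycleLength G) (2 * R.pos a s) (2 * i + 1) ≠
        2 * circDist (cycleLength G) (R.pos a s) k + 1 := by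
  obtain ⟨s, hs, h⟩ := hT _ (R.parEdge_mem hx) _ (cycleEdge_mem ha hi)
    (parEdge_ne_cycleEdge ha hi hx)
  refine ⟨s, hs, fun hc => h ?_⟩
  rw [R.edgeDist_par_of_notMem_desc hx (hfree s hs), hxk, R.dist_cycle (ha.mem hk),
    ← R.apply_pos ha s, ha.dist_eq R (R.pos_lt ha s) hk]
  have := EdgeAt.edgeDist_cycle (R := R) ha s hi
  omega

end Rooting

variable [Fintype V] [DecidableRel G.Adj]

lemma EdgeOddOrEven.mem_Icc {a : ℕ → V} {j : ℕ} (h : EdgeOddOrEven G a j) :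
    j ∈ Set.Icc 1 ((cycleLength G - 1) / 2) := by
  rcases h with h | h <;> exact h.2.1

lemma EdgeOddOrEven.edgeCommon {a : ℕ → V} {j : ℕ} (h : EdgeOddOrEven G a j) :
    EdgeCommon G a j := by
  rcases h with h | h <;> exact h.2.2.1

namespace Rooting

variable {R : Rooting G} {a : ℕ → V}

/-- A missed branch at `c` would be a thread. The element making `c` active lies off the cycle by
`hcyc`, hence in another branch, and so `c` would be bad. -/
lemma Resolves.exists_mem_desc {T : Finset V} (hT : R.Resolves T) {c x : V}
    (hact : c ∈ activeVerts G T) (hbad : ¬ IsBad G c)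
    (hcyc : ∀ s ∈ T, s ∈ cycleVerts G → treeAt G s = {s}) (hx : x ∉ cycleVerts G)
    (hxc : R.par x = c) : ∃ s ∈ T, s ∈ R.desc x := by
  by_contra! hcon
  obtain ⟨s, hs, hsc⟩ := R.mem_activeVerts_iff.1 hact
  have hc := hact.1
  have hne : s ∉ cycleVerts G := by
    intro hsC
    have h1 := hcyc s hs hsC
    rw [R.root_cycle hsC] at hsc
    have h2 : x ∈ treeAt G s := by
      rw [R.mem_treeAt_iff hsC, ← R.root_par, hxc, R.root_cycle hc, hsc]
    rw [h1] at h2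
    exact hx (h2 ▸ hsC)
  obtain ⟨y, hy, hsy, hyc⟩ := R.exists_top hne
  rw [hsc] at hyc
  have hxy : x ≠ y := by
    rintro rfl
    exact hcon s hs hsy
  have h4 := R.four_le_degree_cycle hc hx hxc hy hyc hxy
  exact hbad ⟨hc, h4, (R.threads_nonempty_iff (by omega)).2
    ⟨x, hT.isThreadTop hx hcon, hxc⟩⟩

/-- The conditions `EdgeOddOrEven` suffice for a branch-resolving set whose active vertices lie
on the arc from `a 0` to `a j` to be an edge metric generator. -/
theorem Resolves.isEdgeMetricGenerator_of_edgeOddOrEven {T : Finset V} (hT : R.Resolves T)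
    (ha : IsCycleLabelling G a) {j : ℕ} (h : EdgeOddOrEven G a j)
    (h0 : a 0 ∈ activeVerts G T) (hj : a j ∈ activeVerts G T) (hle : ∀ s ∈ T, R.pos a s ≤ j)
    (hcyc : ∀ s ∈ T, s ∈ cycleVerts G → treeAt G s = {s}) : IsEdgeMetricGenerator G T := by
  obtain ⟨hj1, hjm⟩ := h.mem_Icc
  obtain ⟨⟨hb0, hbj⟩, htriv⟩ := h.edgeCommon
  have h3 := R.three_le
  obtain ⟨s0, hs0, hp0⟩ := exists_pos_of_active (R := R) ha (by omega) h0
  obtain ⟨s1, hs1, hp1⟩ := exists_pos_of_active (R := R) ha (by omega) hj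
  refine hT.isEdgeMetricGenerator ha (fun i => ?_) ?_
  · by_cases hi : i = 0
    · exact ⟨s1, hs1, by omega⟩
    · exact ⟨s0, hs0, by omega⟩
  intro e f p q t u he hf hpq htu hd hc
  have hpl := he.lt ha
  have hql := hf.lt ha
  have e0 := hc s0 hs0
  have e1 := hc s1 hs1
  rw [hp0, mul_zero] at e0
  rw [hp1] at e1
  have hu : -1 ≤ u := by
    rcases hf with ⟨i, -, -, -, rfl⟩ | ⟨x, hx, -, -, rfl⟩
    · rfl
    · have := R.height_pos hx; omega
  -- In every case the shift is positive, so `t` exceeds the minimal value -1 and `e` is a tree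
  -- edge.
  have hcases := positions_of_two (l := cycleLength G) (J := 2 * j) (p := p) (q := q) (t := t - u)
    (by omega) (by omega) hpl hql hpq (by omega) (by omega) (by omega)
  have ht : u + 1 ≤ t := by omega
  obtain ⟨x, hx, rfl, rfl, rfl⟩ : ∃ x, x ∉ cycleVerts G ∧ e = s(x, R.par x) ∧
      p = 2 * R.pos a x ∧ t = 2 * R.height x - 2 := by
    rcases he with ⟨i, -, -, -, rfl⟩ | he
    · omega
    · exact he
  have htree : ∀ k, R.pos a x = k → treeAt G (a k) ≠ {a k} := by
    rintro k rfl hk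
    rw [R.apply_pos ha] at hk
    have : x ∈ treeAt G (R.root x) := (R.mem_treeAt_iff (R.root_mem x)).2 rfl
    rw [hk] at this
    have : x = R.root x := this
    exact hx (this ▸ R.root_mem x)
  have hhit0 : R.pos a x ≠ 0 := fun h => no_edge_at_hit ha (by omega)
    (fun y hy hyc => hT.exists_mem_desc h0 hb0 hcyc hy hyc) hx h hd
  have hhitj : R.pos a x ≠ j := fun h => no_edge_at_hit ha (by omega)
    (fun y hy hyc => hT.exists_mem_desc hj hbj hcyc hy hyc) hx h hd
  rcases hcases with ⟨c1, c2, c3, -⟩ | ⟨c1, -⟩ | ⟨c1, c2, -⟩ | ⟨c1, c2, c3, c4⟩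
  · refine htree _ rfl (htriv (by omega) _ (Or.inr ⟨by omega, by omega⟩))
  · omega
  · exact htree _ rfl (htriv (by omega) _ (Or.inl ⟨by omega, by omega⟩))
  -- Fourth configuration: no active vertex is interior to the arc, so all trees away from `a 0` and
  -- `a j` are free of branching, and (iii) or (iv) applies.
  · have hpos : ∀ s ∈ T, R.pos a s = 0 ∨ R.pos a s = j := by
      intro s hs
      by_contra! hne
      have := hle s hs
      refine not_third (l := cycleLength G) (J := 2 * j) (K := 2 * R.pos a s)
        (p := 2 * R.pos a x) (q := q) (by omega) (by omega) (by omega) c1 c2 c3 ?_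
      have := hc s hs
      omega
    have hnb : ∀ k, 0 < k → k ≠ j → k < cycleLength G → NoBranching G (a k) := by
      intro k hk hkj hkl
      refine hT.noBranching (ha.mem hkl) fun hact => ?_
      obtain ⟨s, hs, hsk⟩ := exists_pos_of_active (R := R) ha hkl hact
      have := hpos s hs
      omega
    have hlen := R.height_le_treeLength x
    rw [← R.apply_pos ha] at hlen
    -- Since q = ℓ + 2j - p with p even, `f` is a cycle edge for odd ℓ and an edge of the tree at k'
    -- = ℓ/2 + j - k for even ℓ, where k is the index of the root of `x`. The height shift then
    -- makes `x` too high.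
    rcases h with ⟨ho, -, -, h⟩ | ⟨hev, -, -, h⟩
    · have := h (by omega) (fun k hk => hnb k hk.1 (by have := hk.2; omega)
        (by have := hk.2; omega)) (R.pos a x) ⟨by omega, by omega⟩
      obtain ⟨m, hm⟩ := ho
      rcases hf with ⟨i, -, -, -, rfl⟩ | ⟨y, -, -, rfl, -⟩ <;> omega
    · obtain ⟨m, hm⟩ := hev
      rcases hf with ⟨i, -, -, hi, -⟩ | ⟨y, hy, -, hqy, rfl⟩
      · omega
      have hpy : cycleLength G / 2 + j - R.pos a x = R.pos a y := by omega
      have := h (by omega) (fun k hk => ⟨hnb k hk.1 (by have := hk.2; omega)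
        (by have := hk.2; omega), hnb _ (by have := hk.2; omega) (by have := hk.2; omega)
        (by have := hk.2; have := hk.1; omega)⟩) (R.pos a x) ⟨by omega, by omega⟩ ?_
      · have := R.height_pos hy
        omega
      · have h5 := R.height_lt_ncard_treeAt y
        have := R.height_pos hy
        rw [hpy, R.apply_pos ha]
        omega

/-- The conditions `EdgeOddOrEven` are necessary for an edge metric generator whose active
vertices lie on the arc from `a 0` to `a j`. -/
theorem edgeOddOrEven_of_isEdgeMetricGenerator {T : Finset V} (hT : IsEdgeMetricGenerator G T)
    (ha : IsCycleLabelling G a) {j : ℕ} (hj : j ∈ Set.Icc 1 ((cycleLength G - 1) / 2))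
    (hle : ∀ s ∈ T, R.pos a s ≤ j)
    (hact : ∀ k ∈ Set.Icc 1 (j - 1), NoBranching G (a k) → a k ∉ activeVerts G T)
    (hbad : ∀ c, c = a 0 ∨ c = a j → IsBad G c →
      ∃ x, x ∉ cycleVerts G ∧ R.par x = c ∧ ∀ s ∈ T, s ∉ R.desc x) : EdgeOddOrEven G a j := by
  obtain ⟨hj1, hjm⟩ := hj
  have h3 := R.three_le
  have hfar : ∀ x, x ∉ cycleVerts G → j < R.pos a x → ∀ s ∈ T, s ∉ R.desc x := by
    intro x hx hxj s hs hsx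
    have h1 := hle s hs
    rw [(R.pos_eq_pos_iff ha).2 (R.root_eq_of_mem_desc hsx)] at h1
    omega
  have htriv : ∀ k, k < cycleLength G → (∀ x, x ∉ cycleVerts G → R.par x ≠ a k) →
      treeAt G (a k) = {a k} := by
    intro k hk h
    ext y
    rw [R.mem_treeAt_iff (ha.mem hk), Set.mem_singleton_iff]
    constructor
    · intro hy
      by_cases hyC : y ∈ cycleVerts G
      · rwa [R.root_cycle hyC] at hy
      · obtain ⟨x, hx, -, hpx⟩ := R.exists_top hyC
        exact absurd (hpx.trans hy) (h x hx)
    · rintro rfl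
      exact R.root_cycle (ha.mem hk)
  have hpos : ∀ x k, k < cycleLength G → R.par x = a k → R.pos a x = k := by
    intro x k hk h
    rw [R.pos_eq_iff ha hk, ← R.root_par, h, R.root_cycle (ha.mem hk)]
  have hcommon : EdgeCommon G a j := by
    refine ⟨⟨fun hb => ?_, fun hb => ?_⟩, fun hjlt k hk => ?_⟩
    · obtain ⟨x, hx, hxc, hfree⟩ := hbad _ (Or.inl rfl) hb
      -- The missed edge at an end of the arc is compared with the cycle edge leaving the arc there:
      -- from the arc, both are reached through that end. Beyond the arc, likewise, the cycle edge
      -- continues away from it.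
      obtain ⟨s, hs, h⟩ := exists_circDist_ne ha hT (i := cycleLength G - 1) (by omega) (by omega)
        hx hxc hfree
      have := hle s hs
      simp only [circDist] at h
      omega
    · obtain ⟨x, hx, hxc, hfree⟩ := hbad _ (Or.inr rfl) hb
      obtain ⟨s, hs, h⟩ := exists_circDist_ne ha hT (i := j) (by omega) (by omega) hx hxc hfree
      have := hle s hs
      simp only [circDist] at h
      omega
    · rcases hk with ⟨hk1, hk2⟩ | ⟨hk1, hk2⟩
      · refine htriv k (by omega) fun x hx hxk => ?_
        obtain ⟨s, hs, h⟩ := exists_circDist_ne ha hT (i := k - 1) (by omega) (by omega) hx hxk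
          (hfar x hx (by rw [hpos x k (by omega) hxk]; omega))
        have := hle s hs
        simp only [circDist] at h
        omega
      · refine htriv k (by omega) fun x hx hxk => ?_
        obtain ⟨s, hs, h⟩ := exists_circDist_ne ha hT (i := k) (by omega) (by omega) hx hxk
          (hfar x hx (by rw [hpos x k (by omega) hxk]; omega))
        have := hle s hs
        simp only [circDist] at h
        omega
  have hends : (∀ k ∈ Set.Icc 1 (j - 1), NoBranching G (a k)) →
      ∀ s ∈ T, R.pos a s = 0 ∨ R.pos a s = j := by
    intro hnb s hs
    by_contra! hne
    have := hle s hs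
    have hk : R.pos a s ∈ Set.Icc 1 (j - 1) := ⟨by omega, by omega⟩
    exact hact _ hk (hnb _ hk) (active_of_mem ha hs)
  rcases Nat.even_or_odd (cycleLength G) with hev | hodd
  · refine Or.inr ⟨hev, ⟨hj1, hjm⟩, hcommon, fun hj hnb k hk hcard => ?_⟩
    by_contra! hlen
    have hends := hends fun k hk => (hnb k hk).1
    obtain ⟨hk1, hk2⟩ := hk
    obtain ⟨m, hm⟩ := hev
    have hk' : cycleLength G / 2 + j - k < cycleLength G := by omega
    -- The height is the least one violating (iv); paired with an edge of height 1 at k', it gives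
    -- equal distances from `a 0` and from `a j`.
    obtain ⟨x, hxr, hxh⟩ := R.exists_height_eq (ha.mem (show k < cycleLength G by omega))
      (hnb k ⟨hk1, hk2⟩).1 (n := cycleLength G / 2 - j + 1) (by omega)
    obtain ⟨y, hyr, hyh⟩ := R.exists_height_eq (ha.mem hk')
      (hnb k ⟨hk1, hk2⟩).2 (n := 1) (by rw [treeLength]; omega)
    have hx : x ∉ cycleVerts G := by rw [← R.height_eq_zero]; omega
    have hy : y ∉ cycleVerts G := by rw [← R.height_eq_zero]; omega
    have hpx := (R.pos_eq_iff ha (by omega)).2 hxr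
    have hpy := (R.pos_eq_iff ha hk').2 hyr
    have hef : s(x, R.par x) ≠ s(y, R.par y) := by
      intro h
      have := R.parEdge_inj hx hy h
      subst this
      omega
    obtain ⟨s, hs, h⟩ := exists_pos_ne_of_isEdgeMetricGenerator (R := R) ha hT (R.parEdge_mem hx)
      (R.parEdge_mem hy) hef (Or.inr ⟨x, hx, rfl, rfl, rfl⟩)
      (Or.inr ⟨y, hy, rfl, rfl, rfl⟩) (fun s hs => by have := hends s hs; omega)
      (fun s hs => by have := hends s hs; omega)
    refine h ?_
    rw [hpx, hpy, hxh, hyh]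
    rcases hends s hs with h | h <;> rw [h] <;> simp only [circDist] <;> omega
  · refine Or.inl ⟨hodd, ⟨hj1, hjm⟩, hcommon, fun hj hnb k hk => ?_⟩
    by_contra! hlen
    have hends := hends hnb
    have hnbk := hnb k hk
    obtain ⟨hk1, hk2⟩ := hk
    obtain ⟨m, hm⟩ := hodd
    obtain ⟨x, hxr, hxh⟩ := R.exists_height_eq (ha.mem (show k < cycleLength G by omega))
      hnbk (n := (cycleLength G - 1) / 2 - j + 1) (by omega)
    have hx : x ∉ cycleVerts G := by rw [← R.height_eq_zero]; omega
    have hpx := (R.pos_eq_iff ha (by omega)).2 hxr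
    -- Here ℓ = 2m + 1, and the midpoint of cycle edge j + m - k is the point q = ℓ + 2j - 2k of the
    -- fourth configuration.
    have hi : j + m - k < cycleLength G := by omega
    obtain ⟨s, hs, h⟩ := exists_pos_ne_of_isEdgeMetricGenerator (R := R) ha hT (R.parEdge_mem hx)
      (cycleEdge_mem ha hi) (parEdge_ne_cycleEdge ha hi hx) (Or.inr ⟨x, hx, rfl, rfl, rfl⟩)
      (Or.inl ⟨_, hi, rfl, rfl, rfl⟩) (fun s hs => by have := hends s hs; omega)
      (fun s hs => by omega)
    refine h ?_
    rw [hpx, hxh]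
    rcases hends s hs with h | h <;> rw [h] <;> simp only [circDist] <;> omega

end Rooting

end Unicyclic

/-! ### Relabelling the cycle, normal labellings, and first bounds on generators -/

namespace Unicyclic

variable {V : Type*} {G : SimpleGraph V}

section Labelling

variable {a : ℕ → V}

lemma IsCycleLabelling.comp (ha : IsCycleLabelling G a) {σ : ℕ → ℕ}
    (hσ : Set.BijOn σ (Set.Iio (cycleLength G)) (Set.Iio (cycleLength G)))
    (h : ∀ i < cycleLength G, σ ((i + 1) % cycleLength G) = (σ i + 1) % cycleLength G ∨
      σ i = (σ ((i + 1) % cycleLength G) + 1) % cycleLength G) :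
    IsCycleLabelling G (fun i => a (σ i)) := by
  refine ⟨ha.1.comp hσ, fun i hi => ?_⟩
  have h1 : σ i < cycleLength G := hσ.mapsTo hi
  have h2 : σ ((i + 1) % cycleLength G) < cycleLength G :=
    hσ.mapsTo (Nat.mod_lt _ (by omega))
  rcases h i hi with h | h
  · have := ha.2 _ h1
    rwa [← h] at this
  · have := ha.2 _ h2
    rw [← h] at this
    exact this.symm

/-- Rotation of a labelling. -/
lemma IsCycleLabelling.rotate (ha : IsCycleLabelling G a) {k : ℕ} (hk : k < cycleLength G) :
    IsCycleLabelling G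
      (fun i => a (if i + k < cycleLength G then i + k else i + k - cycleLength G)) := by
  refine ha.comp ⟨fun i hi => ?_, fun i hi j hj h => ?_, fun i hi => ?_⟩ fun i hi => ?_
  · rw [Set.mem_Iio] at hi ⊢
    dsimp only
    split_ifs <;> omega
  · rw [Set.mem_Iio] at hi hj
    dsimp only at h
    split_ifs at h <;> omega
  · rw [Set.mem_Iio] at hi
    by_cases h : k ≤ i
    · refine ⟨i - k, by rw [Set.mem_Iio]; omega, ?_⟩
      dsimp only
      split_ifs <;> omega
    · refine ⟨i + cycleLength G - k, by rw [Set.mem_Iio]; omega, ?_⟩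
      dsimp only
      split_ifs <;> omega
  · left
    rw [succ_mod hi, succ_mod (show (if i + k < cycleLength G then i + k else
      i + k - cycleLength G) < cycleLength G by split_ifs <;> omega)]
    split_ifs <;> omega

/-- Reversal of a labelling. -/
lemma IsCycleLabelling.reflect (ha : IsCycleLabelling G a) :
    IsCycleLabelling G (fun i => a (if i = 0 then 0 else cycleLength G - i)) := by
  refine ha.comp ⟨fun i hi => ?_, fun i hi j hj h => ?_, fun i hi => ?_⟩ fun i hi => ?_
  · rw [Set.mem_Iio] at hi ⊢
    dsimp only
    split_ifs <;> omega
  · rw [Set.mem_Iio] at hi hj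
    dsimp only at h
    split_ifs at h <;> omega
  · rw [Set.mem_Iio] at hi
    by_cases h : i = 0
    · exact ⟨0, by rw [Set.mem_Iio]; omega, by simp [h]⟩
    · refine ⟨cycleLength G - i, by rw [Set.mem_Iio]; omega, ?_⟩
      dsimp only
      split_ifs <;> omega
  · right
    have hs := succ_mod hi
    generalize (i + 1) % cycleLength G = n at hs ⊢
    rw [succ_mod (show (if n = 0 then 0 else cycleLength G - n) < cycleLength G by
      split_ifs <;> omega)]
    split_ifs at hs ⊢ <;> omega

lemma exists_labelling_zero (R : Rooting G) {u : V} (hu : u ∈ cycleVerts G) :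
    ∃ a, IsCycleLabelling G a ∧ a 0 = u := by
  obtain ⟨a, ha⟩ := R.exists_labelling
  obtain ⟨k, hk, rfl⟩ := ha.1.surjOn hu
  rw [Set.mem_Iio] at hk
  exact ⟨_, ha.rotate hk, by simp [hk]⟩

lemma exists_labelling_pair (R : Rooting G) {u w : V} (hu : u ∈ cycleVerts G)
    (hw : w ∈ cycleVerts G) (huw : u ≠ w) :
    ∃ a j, IsCycleLabelling G a ∧ a 0 = u ∧ a j = w ∧ 1 ≤ j ∧ 2 * j ≤ cycleLength G := by
  obtain ⟨a, ha, rfl⟩ := exists_labelling_zero R hu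
  obtain ⟨k, hk, rfl⟩ := ha.1.surjOn hw
  rw [Set.mem_Iio] at hk
  have hk0 : k ≠ 0 := by rintro rfl; exact huw rfl
  by_cases h : 2 * k ≤ cycleLength G
  · exact ⟨a, k, ha, rfl, rfl, by omega, h⟩
  · refine ⟨_, cycleLength G - k, ha.reflect, rfl, ?_, by omega, by omega⟩
    rw [if_neg (by omega)]
    congr 1
    omega

lemma isGeodesicTriple_of_le (R : Rooting G) (ha : IsCycleLabelling G a) {i j k : ℕ} (hij : i < j)
    (hjk : j < k) (hk : k < cycleLength G) (h1 : 2 * (j - i) ≤ cycleLength G)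
    (h2 : 2 * (k - j) ≤ cycleLength G) (h3 : cycleLength G ≤ 2 * (k - i)) :
    IsGeodesicTriple G (a i) (a j) (a k) := by
  refine ⟨ha.mem (by omega), ha.mem (by omega), ha.mem hk, fun h => ?_, fun h => ?_, fun h => ?_,
    ?_⟩
  · have := ha.inj (by omega) (by omega) h; omega
  · have := ha.inj (by omega) (by omega) h; omega
  · have := ha.inj (by omega) (by omega) h; omega
  · rw [ha.dist_eq R (by omega) (by omega), ha.dist_eq R (by omega) (by omega),
      ha.dist_eq R (by omega) (by omega)]
    simp only [circDist]
    omega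

/-- The index ℓ/2 + 1 lies just past the antipode of `a 0`, so no open half circle contains all
three points, whatever j between 1 and ℓ/2 is. -/
lemma isGeodesicTriple_completion (R : Rooting G) (ha : IsCycleLabelling G a) {j : ℕ} (hj : 1 ≤ j)
    (hjl : 2 * j ≤ cycleLength G) :
    IsGeodesicTriple G (a 0) (a j) (a (cycleLength G / 2 + 1)) := by
  have := R.three_le
  exact isGeodesicTriple_of_le R ha (by omega) (by omega) (by omega) (by omega) (by omega)
    (by omega)

variable {S : Finset V}

lemma maxActiveIndex_mem (h0 : ∃ i < cycleLength G, a i ∈ activeVerts G S) :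
    maxActiveIndex G a S < cycleLength G ∧ a (maxActiveIndex G a S) ∈ activeVerts G S :=
  Nat.sSup_mem (s := {i | i < cycleLength G ∧ a i ∈ activeVerts G S}) h0
    ⟨cycleLength G, fun _ hi => hi.1.le⟩

lemma le_maxActiveIndex {i : ℕ} (hi : i < cycleLength G) (h : a i ∈ activeVerts G S) :
    i ≤ maxActiveIndex G a S :=
  le_csSup (s := {i | i < cycleLength G ∧ a i ∈ activeVerts G S})
    ⟨cycleLength G, fun _ hi => hi.1.le⟩ ⟨hi, h⟩

/-- Without geodesic triples of active vertices, a normal labelling puts all active vertices on an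
arc of less than half the cycle, unless there are only two, antipodal, active vertices. -/
lemma IsNormalLabelling.maxActiveIndex_lt (R : Rooting G) (h : IsNormalLabelling G a S)
    (hanti : ∃ i < cycleLength G, a i ∈ activeVerts G S ∧ i ≠ 0 ∧ 2 * i ≠ cycleLength G)
    (htri : ¬ ∃ x ∈ activeVerts G S, ∃ y ∈ activeVerts G S, ∃ z ∈ activeVerts G S,
      IsGeodesicTriple G x y z) : 2 * maxActiveIndex G a S < cycleLength G := by
  classical
  obtain ⟨ha, h0, hmin⟩ := h
  have h3 := R.three_le
  obtain ⟨hjl, hja⟩ := maxActiveIndex_mem ⟨0, by omega, h0⟩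
  have hle := fun i => le_maxActiveIndex (G := G) (a := a) (S := S) (i := i)
  set j := maxActiveIndex G a S
  by_contra! hcon
  have hmid : ∀ k, k < cycleLength G → a k ∈ activeVerts G S → 0 < k → k < j →
      2 * k ≤ cycleLength G → 2 * (j - k) ≤ cycleLength G → False :=
    fun k hk hka hk0 hkj h1 h2 => htri ⟨_, h0, _, hka, _, hja,
      isGeodesicTriple_of_le R ha hk0 hkj hjl (by omega) h2 (by omega)⟩
  rcases hcon.lt_or_eq with hlt | heq
  -- `k1` is the last active index more than half a turn behind `j`, and `k2` the first one past the
  -- antipode of `a 0`. Without a triple, the labelling rotated to start at `k2` has its last active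
  -- vertex at most at `k1`, which beats the minimality of `j`.
  · obtain ⟨k1, hk1, hk1'⟩ : ∃ k1, (2 * k1 + cycleLength G < 2 * j ∧ a k1 ∈ activeVerts G S) ∧
        ∀ i, 2 * i + cycleLength G < 2 * j → a i ∈ activeVerts G S → i ≤ k1 := by
      let P : ℕ → Prop := fun k => 2 * k + cycleLength G < 2 * j ∧ a k ∈ activeVerts G S
      refine ⟨Nat.findGreatest P j, Nat.findGreatest_spec (P := P) (m := 0) (by omega)
        ⟨by omega, h0⟩, fun i h1 h2 => Nat.le_findGreatest (P := P) (by omega) ⟨h1, h2⟩⟩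
    have hex : ∃ k, k < cycleLength G ∧ cycleLength G < 2 * k ∧ a k ∈ activeVerts G S :=
      ⟨j, hjl, hlt, hja⟩
    obtain ⟨hk2l, hk2, hk2a⟩ := Nat.find_spec hex
    have hk2' : ∀ i, i < cycleLength G → cycleLength G < 2 * i → a i ∈ activeVerts G S →
        Nat.find hex ≤ i := fun i h1 h2 h3 => Nat.find_min' hex ⟨h1, h2, h3⟩
    set k2 := Nat.find hex
    have hkj := hle k2 hk2l hk2a
    have hb := hmin _ (ha.rotate hk2l) (by simpa [hk2l] using hk2a)
    obtain ⟨hm1, hm2⟩ := maxActiveIndex_mem (G := G) (S := S)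
      (a := fun i => a (if i + k2 < cycleLength G then i + k2 else i + k2 - cycleLength G))
      ⟨0, by omega, by simpa [hk2l] using hk2a⟩
    set M := maxActiveIndex G
      (fun i => a (if i + k2 < cycleLength G then i + k2 else i + k2 - cycleLength G)) S
    split_ifs at hm2 with hc
    · have := hle _ hc hm2
      omega
    · by_cases h1 : 2 * (M + k2 - cycleLength G) + cycleLength G < 2 * j
      · have := hk1' _ h1 hm2
        omega
      by_cases h2 : cycleLength G < 2 * (M + k2 - cycleLength G)
      · have := hk2' _ (by omega) h2 hm2
        omega
      · exact hmid _ (by omega) hm2 (by omega) (by omega) (by omega) (by omega)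
  · obtain ⟨i, hi, hia, hi0, hil⟩ := hanti
    have := hle i hi hia
    exact hmid i hi hia (by omega) (by omega) (by omega) (by omega)

end Labelling

lemma edim_eq {T : Finset V} (hT : IsEdgeMetricGenerator G T) {n : ℕ} (hn : T.card ≤ n)
    (h : ∀ T', IsEdgeMetricGenerator G T' → n ≤ T'.card) : edim G = n := by
  apply le_antisymm
  · have hmem : T.card ∈ {n | ∃ S : Finset V, IsEdgeMetricGenerator G S ∧ S.card = n} :=
      ⟨T, hT, rfl⟩
    exact (Nat.sInf_le hmem).trans hn
  · have hne : {n | ∃ S : Finset V, IsEdgeMetricGenerator G S ∧ S.card = n}.Nonempty :=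
      ⟨T.card, T, hT, rfl⟩
    obtain ⟨T', hT', hc⟩ := Nat.sInf_mem hne
    exact (h T' hT').trans_eq hc

namespace Rooting

variable {R : Rooting G} {a : ℕ → V}

/-- The active vertices of an edge metric generator are not contained in an antipodal pair. -/
lemma exists_pos_of_isEdgeMetricGenerator (ha : IsCycleLabelling G a) {T : Finset V}
    (hT : IsEdgeMetricGenerator G T) :
    ∃ s ∈ T, R.pos a s ≠ 0 ∧ 2 * R.pos a s ≠ cycleLength G := by
  have h3 := R.three_le
  -- The two cycle edges at `a 0` are swapped by the reflection that fixes `a 0` and its antipode,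
  -- so vertices over those positions cannot tell them apart.
  have hne : s(a 0, a ((0 + 1) % cycleLength G)) ≠
      s(a (cycleLength G - 1), a ((cycleLength G - 1 + 1) % cycleLength G)) := by
    rw [succ_mod (show 0 < cycleLength G by omega),
      succ_mod (show cycleLength G - 1 < cycleLength G by omega), if_neg (by omega),
      if_pos (by omega)]
    intro h
    rw [Sym2.eq_iff] at h
    rcases h with ⟨h, -⟩ | ⟨-, h⟩
    · have := ha.inj (by omega) (by omega) h; omega
    · have := ha.inj (by omega) (by omega) h; omega
  obtain ⟨s, hs, h⟩ := hT _ (cycleEdge_mem ha (by omega)) _ (cycleEdge_mem ha (by omega)) hne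
  refine ⟨s, hs, ?_⟩
  by_contra hcon
  have h1 := EdgeAt.edgeDist_cycle (R := R) ha s (i := 0) (by omega)
  have h2 := EdgeAt.edgeDist_cycle (R := R) ha s (i := cycleLength G - 1) (by omega)
  have h4 : circDist (2 * cycleLength G) (2 * R.pos a s) (2 * 0 + 1) =
      circDist (2 * cycleLength G) (2 * R.pos a s) (2 * (cycleLength G - 1) + 1) := by
    simp only [circDist]
    omega
  rw [h4] at h1
  omega

lemma exists_root_ne_of_isEdgeMetricGenerator {T : Finset V}
    (hT : IsEdgeMetricGenerator G T) {c : V} (hc : c ∈ cycleVerts G) :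
    ∃ s ∈ T, R.root s ≠ c := by
  obtain ⟨a, ha, rfl⟩ := exists_labelling_zero R hc
  obtain ⟨s, hs, h, -⟩ := exists_pos_of_isEdgeMetricGenerator (R := R) ha hT
  have := R.three_le
  exact ⟨s, hs, fun h' => h ((R.pos_eq_iff ha (by omega)).2 h')⟩

lemma two_le_card_of_isEdgeMetricGenerator (R : Rooting G) (hT : IsEdgeMetricGenerator G T) :
    2 ≤ T.card := by
  obtain ⟨a, ha⟩ := R.exists_labelling
  have h3 := R.three_le
  obtain ⟨s, hs, -⟩ := exists_root_ne_of_isEdgeMetricGenerator (R := R) hT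
    (ha.mem (show 0 < cycleLength G by omega))
  obtain ⟨t, ht, hts⟩ := exists_root_ne_of_isEdgeMetricGenerator (R := R) hT (R.root_mem s)
  exact Finset.one_lt_card.2 ⟨s, hs, t, ht, fun h => hts (h ▸ rfl)⟩

/-- A vertex of the tree at `c`, off the cycle if possible. -/
lemma exists_representative (R : Rooting G) {c : V} (hc : c ∈ cycleVerts G) :
    ∃ s, R.root s = c ∧ (s ∈ cycleVerts G → treeAt G s = {s}) := by
  by_cases h : ∃ s, s ∉ cycleVerts G ∧ R.root s = c
  · obtain ⟨s, hs, hsc⟩ := h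
    exact ⟨s, hsc, fun h => absurd h hs⟩
  · refine ⟨c, R.root_cycle hc, fun _ => ?_⟩
    ext y
    rw [R.mem_treeAt_iff hc, Set.mem_singleton_iff]
    constructor
    · intro hy
      by_cases hyC : y ∈ cycleVerts G
      · rwa [R.root_cycle hyC] at hy
      · exact absurd ⟨y, hyC, hy⟩ h
    · rintro rfl
      exact R.root_cycle hc

lemma active_of_mem_cycle (R : Rooting G) {T : Finset V} {c : V} (hc : c ∈ cycleVerts G) (h : c ∈ T) :
    c ∈ activeVerts G T := R.mem_activeVerts_iff.2 ⟨c, h, R.root_cycle hc⟩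

end Rooting

lemma activeVerts_mono {S T : Finset V} (h : S ⊆ T) : activeVerts G S ⊆ activeVerts G T := by
  rintro c ⟨hc, s, hs, hsc⟩
  exact ⟨hc, s, h hs, hsc⟩

end Unicyclic

/-! ### The edge metric dimension in the three cases -/

namespace Unicyclic

variable {V : Type*} {G : SimpleGraph V} [Fintype V] [DecidableRel G.Adj]

namespace Rooting

variable {R : Rooting G} {S T : Finset V}

lemma isBranching_of_isBad {c : V} (h : IsBad G c) : IsBranching G c := Or.inl ⟨h.1, h.2.1⟩

lemma not_noBranching_of_isBad (R : Rooting G) {c : V} (h : IsBad G c) : ¬ NoBranching G c :=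
  fun hb => hb c ((R.mem_treeAt_iff h.1).2 (R.root_cycle h.1)) (isBranching_of_isBad h)

/-- The right-hand side does not mention `S`: all minimum resolving sets have the same active
vertices, so a generator of minimum size can be compared with `S`. -/
lemma IsMinResolving.mem_active_iff (hS : R.IsMinResolving S) {c : V} (hc : c ∈ cycleVerts G) :
    c ∈ activeVerts G S ↔ ¬ NoBranching G c :=
  ⟨fun h => hS.not_noBranching h, fun h => by
    by_contra hact
    exact h (hS.1.noBranching hc hact)⟩

lemma IsMinResolving.exists_free (hS : R.IsMinResolving S) {c : V} (h : IsBad G c) :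
    ∃ x, x ∉ cycleVerts G ∧ R.par x = c ∧ ∀ s ∈ S, s ∉ R.desc x := by
  obtain ⟨x, hx, hxc⟩ := (R.threads_nonempty_iff (by have := h.2.1; omega)).1 h.2.2
  obtain ⟨y, hy, hyc, hfree⟩ := hS.exists_free_top h.1 hx hxc
  exact ⟨y, hy.1, hyc, hfree⟩

lemma exists_geodesic_extension (R : Rooting G) [DecidableEq V] {a : ℕ → V}
    (ha : IsCycleLabelling G a)
    (hT : R.Resolves T) {j : ℕ} (hj : 1 ≤ j) (hjl : 2 * j ≤ cycleLength G)
    (h0 : a 0 ∈ activeVerts G T) (hja : a j ∈ activeVerts G T) :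
    IsEdgeMetricGenerator G (insert (a (cycleLength G / 2 + 1)) T) := by
  have h3 := R.three_le
  have hsub : T ⊆ insert (a (cycleLength G / 2 + 1)) T := Finset.subset_insert _ _
  exact (hT.mono hsub).isEdgeMetricGenerator_of_triple (activeVerts_mono hsub h0)
    (activeVerts_mono hsub hja)
    (R.active_of_mem_cycle (ha.mem (by omega)) (Finset.mem_insert_self _ _))
    (isGeodesicTriple_completion R ha hj hjl)

/-- If the active vertices of an edge metric generator are `u` and `w`, and it misses a thread at
each of them that is bad, then `EdgeOddOrEven` holds for a labelling with `a 0 = u`. -/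
lemma exists_edgeOddOrEven (hT : IsEdgeMetricGenerator G T) {u w : V} (hu : u ∈ cycleVerts G)
    (hw : w ∈ cycleVerts G) (huw : u ≠ w) (hroot : ∀ s ∈ T, R.root s = u ∨ R.root s = w)
    (hbad : ∀ c, c = u ∨ c = w → IsBad G c →
      ∃ x, x ∉ cycleVerts G ∧ R.par x = c ∧ ∀ s ∈ T, s ∉ R.desc x) :
    ∃ a j, IsCycleLabelling G a ∧ a 0 = u ∧ EdgeOddOrEven G a j := by
  obtain ⟨a, j, ha, rfl, rfl, hj1, hjl⟩ := exists_labelling_pair R hu hw huw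
  have h3 := R.three_le
  have hpos : ∀ s ∈ T, R.pos a s = 0 ∨ R.pos a s = j := by
    intro s hs
    rw [R.pos_eq_iff ha (by omega), R.pos_eq_iff ha (by omega)]
    exact hroot s hs
  -- This excludes antipodal `u` and `w`, improving 2j ≤ ℓ to a strict inequality.
  obtain ⟨s, hs, hs0, hsl⟩ := exists_pos_of_isEdgeMetricGenerator (R := R) ha hT
  have hsj := hpos s hs
  refine ⟨a, j, ha, rfl, edgeOddOrEven_of_isEdgeMetricGenerator hT ha ⟨hj1, by omega⟩
    (fun t ht => ?_) (fun k hk _ hact => ?_) hbad⟩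
  · have := hpos t ht; omega
  · obtain ⟨hk1, hk2⟩ := hk
    obtain ⟨t, ht, htk⟩ := exists_pos_of_active (R := R) ha (by omega) hact
    have := hpos t ht
    omega

lemma notMem_cycle_of_leaf (R : Rooting G) (hleaf : ∀ s ∈ S, G.degree s = 1) {s : V}
    (hs : s ∈ S) : s ∉ cycleVerts G := by
  intro hC
  have h1 := hleaf s hs
  have h2 := R.two_le_degree hC
  omega

/-- Enlarging a set of leaves by representatives of the trees at `a 0` and `a j`. -/
lemma isEdgeMetricGenerator_insert [DecidableEq V] (hS : R.Resolves S)
    (hleaf : ∀ s ∈ S, G.degree s = 1) {a : ℕ → V} (ha : IsCycleLabelling G a) {j : ℕ}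
    (h : EdgeOddOrEven G a j) (hroot : ∀ s ∈ S, R.root s = a 0 ∨ R.root s = a j)
    {Q : Finset V} (hQroot : ∀ s ∈ Q, R.root s = a 0 ∨ R.root s = a j)
    (hQ : ∀ s ∈ Q, s ∈ cycleVerts G → treeAt G s = {s})
    (h0 : a 0 ∈ activeVerts G (S ∪ Q)) (hj : a j ∈ activeVerts G (S ∪ Q)) :
    IsEdgeMetricGenerator G (S ∪ Q) := by
  have h3 := R.three_le
  obtain ⟨hj1, hjm⟩ := h.mem_Icc
  refine (hS.mono Finset.subset_union_left).isEdgeMetricGenerator_of_edgeOddOrEven ha h h0 hj ?_ ?_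
  · intro s hs
    have : R.root s = a 0 ∨ R.root s = a j := by
      rcases Finset.mem_union.1 hs with hs | hs
      · exact hroot s hs
      · exact hQroot s hs
    rw [← R.pos_eq_iff ha (by omega), ← R.pos_eq_iff ha (by omega)] at this
    omega
  · intro s hs hsC
    rcases Finset.mem_union.1 hs with hs | hs
    · exact absurd hsC (notMem_cycle_of_leaf R hleaf hs)
    · exact hQ s hs hsC

lemma endpoints_of_edgeOddOrEven {a : ℕ → V} (R : Rooting G) (ha : IsCycleLabelling G a) {j : ℕ}
    (h : EdgeOddOrEven G a j) : a 0 ≠ a j ∧ a 0 ∈ cycleVerts G ∧ a j ∈ cycleVerts G := by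
  have h3 := R.three_le
  obtain ⟨hj1, hjm⟩ := h.mem_Icc
  refine ⟨fun h => ?_, ha.mem (by omega), ha.mem (by omega)⟩
  have := ha.inj (by omega) (by omega) h
  omega

/-- Here `S` is empty and nothing is bad. A generator of size 2 must occupy two different trees, to
which `exists_edgeOddOrEven` applies. -/
theorem edim_of_no_active (hS : R.IsMinResolving S) (hleaf : ∀ s ∈ S, G.degree s = 1)
    (hact : activeVerts G S = ∅) :
    ((∃ (a : ℕ → V) (j : ℕ), IsCycleLabelling G a ∧ EdgeOddOrEven G a j) → edim G = 2) ∧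
    ((¬ ∃ (a : ℕ → V) (j : ℕ), IsCycleLabelling G a ∧ EdgeOddOrEven G a j) → edim G = 3) := by
  classical
  have h3 := R.three_le
  have hempty : S = ∅ := by
    rw [Finset.eq_empty_iff_forall_notMem]
    intro s hs
    have : R.root s ∈ activeVerts G S := R.mem_activeVerts_iff.2 ⟨s, hs, rfl⟩
    rw [hact] at this
    exact this
  subst hempty
  constructor
  · rintro ⟨a, j, ha, h⟩
    obtain ⟨-, h0, hj⟩ := endpoints_of_edgeOddOrEven R ha h
    obtain ⟨s, hs, hs'⟩ := R.exists_representative h0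
    obtain ⟨t, ht, ht'⟩ := R.exists_representative hj
    refine edim_eq (T := ∅ ∪ {s, t}) ?_ (by rw [Finset.empty_union]; exact Finset.card_le_two)
      fun T' hT' => two_le_card_of_isEdgeMetricGenerator R hT'
    refine isEdgeMetricGenerator_insert hS.1 hleaf ha h (by simp) (by simp [hs, ht])
      (by simpa using ⟨hs', ht'⟩) (R.mem_activeVerts_iff.2 ⟨s, by simp, hs⟩)
      (R.mem_activeVerts_iff.2 ⟨t, by simp, ht⟩)
  · intro hno
    obtain ⟨a, ha⟩ := R.exists_labelling
    refine edim_eq (exists_geodesic_extension R ha (T := {a 0, a 1})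
      (hS.1.mono (Finset.empty_subset _)) (j := 1) le_rfl (by omega)
      (R.active_of_mem_cycle (ha.mem (by omega)) (by simp))
      (R.active_of_mem_cycle (ha.mem (by omega)) (by simp))) Finset.card_le_three
      fun T' hT' => ?_
    have h2 := two_le_card_of_isEdgeMetricGenerator R hT'
    by_contra! hlt
    obtain ⟨s, t, hst, rfl⟩ := Finset.card_eq_two.1 (show T'.card = 2 by omega)
    have hne : R.root s ≠ R.root t := by
      intro h
      obtain ⟨r, hr, hrs⟩ := exists_root_ne_of_isEdgeMetricGenerator (R := R) hT' (R.root_mem s)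
      simp only [Finset.mem_insert, Finset.mem_singleton] at hr
      rcases hr with rfl | rfl
      · exact hrs rfl
      · exact hrs h.symm
    obtain ⟨b, j, hb, -, h⟩ := exists_edgeOddOrEven (R := R) hT' (R.root_mem s) (R.root_mem t) hne
      (by simp) fun c hc hbad => by
        have := (hS.mem_active_iff hbad.1).2 (not_noBranching_of_isBad R hbad)
        rw [hact] at this
        exact absurd this (Set.notMem_empty _)
    exact hno ⟨b, j, hb, h⟩

theorem edim_of_one_active (hS : R.IsMinResolving S) (hleaf : ∀ s ∈ S, G.degree s = 1) {v : V}
    (hact : activeVerts G S = {v}) :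
    ((∃ (a : ℕ → V) (j : ℕ), IsCycleLabelling G a ∧ (a 0 = v ∨ a j = v) ∧
      EdgeOddOrEven G a j) → edim G = S.card + 1) ∧
    ((¬ ∃ (a : ℕ → V) (j : ℕ), IsCycleLabelling G a ∧ (a 0 = v ∨ a j = v) ∧
      EdgeOddOrEven G a j) → edim G = S.card + 2) := by
  classical
  have h3 := R.three_le
  have hv : v ∈ activeVerts G S := hact ▸ rfl
  have hvC := hv.1
  have hroot : ∀ s ∈ S, R.root s = v := by
    intro s hs
    have : R.root s ∈ activeVerts G S := R.mem_activeVerts_iff.2 ⟨s, hs, rfl⟩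
    rw [hact] at this
    exact this
  have hbranch : ∀ c ∈ cycleVerts G, ¬ NoBranching G c → c = v := by
    intro c hc h
    have := (hS.mem_active_iff hc).2 h
    rw [hact] at this
    exact this
  -- Only the tree at `v` branches, so all sibling threads lie in it. The part of `T` in that tree
  -- already resolves, and a generator needs at least one further element elsewhere.
  have hfilter : ∀ T : Finset V, R.Resolves T → R.Resolves (T.filter fun s => R.root s = v) := by
    intro T hT x y hx hy hxy hne
    have hr : R.root (R.par x) = v := by
      refine hbranch _ (R.root_mem _) fun hb => hb (R.par x)
        ((R.mem_treeAt_iff (R.root_mem _)).2 rfl)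
        (R.isBranching_of_children hx.1 rfl hy.1 hxy.symm hne)
    rcases hT x y hx hy hxy hne with ⟨s, hs, hsx⟩ | ⟨s, hs, hsy⟩
    · refine Or.inl ⟨s, Finset.mem_filter.2 ⟨hs, ?_⟩, hsx⟩
      rw [R.root_eq_of_mem_desc hsx, ← R.root_par, hr]
    · refine Or.inr ⟨s, Finset.mem_filter.2 ⟨hs, ?_⟩, hsy⟩
      rw [R.root_eq_of_mem_desc hsy, ← R.root_par, ← hxy, hr]
  have hlow : ∀ T, IsEdgeMetricGenerator G T → S.card + 1 ≤ T.card := by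
    intro T hT
    have h1 := hS.2 _ (hfilter T (R.resolves_of_isEdgeMetricGenerator hT))
    obtain ⟨s, hs, hsv⟩ := exists_root_ne_of_isEdgeMetricGenerator (R := R) hT hvC
    have : (T.filter fun s => R.root s = v).card < T.card :=
      Finset.card_lt_card (Finset.filter_ssubset.2 ⟨s, hs, hsv⟩)
    omega
  constructor
  · rintro ⟨a, j, ha, hav, h⟩
    obtain ⟨-, h0, hj⟩ := endpoints_of_edgeOddOrEven R ha h
    obtain ⟨w, hwC, hw, hvw⟩ : ∃ w ∈ cycleVerts G, (w = a 0 ∨ w = a j) ∧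
        ∀ c, c = a 0 ∨ c = a j → c = v ∨ c = w := by
      rcases hav with rfl | rfl
      · exact ⟨a j, hj, Or.inr rfl, fun c hc => hc⟩
      · exact ⟨a 0, h0, Or.inl rfl, fun c hc => hc.symm⟩
    obtain ⟨s, hs, hs'⟩ := R.exists_representative hwC
    have hQact : ∀ c, c = a 0 ∨ c = a j → c ∈ activeVerts G (S ∪ {s}) := by
      intro c hc
      rcases hvw c hc with rfl | rfl
      · exact activeVerts_mono Finset.subset_union_left hv
      · exact R.mem_activeVerts_iff.2 ⟨s, by simp, hs⟩
    refine edim_eq (T := S ∪ {s}) (isEdgeMetricGenerator_insert hS.1 hleaf ha h ?_ ?_ ?_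
      (hQact _ (Or.inl rfl)) (hQact _ (Or.inr rfl))) ?_ hlow
    · intro t ht
      rw [hroot t ht]
      exact hav.imp Eq.symm Eq.symm
    · simpa [hs] using hw
    · simpa using hs'
    · exact (Finset.card_union_le _ _).trans (by simp)
  · intro hno
    obtain ⟨b, hb, hb0⟩ := exists_labelling_zero R hvC
    have hsub : S ⊆ insert (b 1) S := Finset.subset_insert _ _
    refine edim_eq (exists_geodesic_extension R hb (T := insert (b 1) S) (hS.1.mono hsub)
      (j := 1) le_rfl (by omega) (activeVerts_mono hsub (hb0 ▸ hv))
      (R.active_of_mem_cycle (hb.mem (by omega)) (Finset.mem_insert_self _ _))) ?_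
      fun T hT => ?_
    · have h1 := Finset.card_insert_le (b (cycleLength G / 2 + 1)) (insert (b 1) S)
      have h2 := Finset.card_insert_le (b 1) S
      omega
    · by_contra! hlt
      have hge := hlow T hT
      have hTr := hfilter T (R.resolves_of_isEdgeMetricGenerator hT)
      have h1 := hS.2 _ hTr
      have hsum := Finset.card_filter_add_card_filter_not (s := T) (fun s => R.root s = v)
      obtain ⟨w, hw, hwv⟩ := exists_root_ne_of_isEdgeMetricGenerator (R := R) hT hvC
      have hwm : w ∈ T.filter fun s => ¬ R.root s = v := Finset.mem_filter.2 ⟨hw, hwv⟩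
      have hpos := Finset.card_pos.2 ⟨w, hwm⟩
      -- With |S| + 1 elements both parts of `T` are as small as possible: the part at `v` is
      -- minimum resolving, so it misses a thread if `v` is bad, and a single element lies outside.
      have hmin : R.IsMinResolving (T.filter fun s => R.root s = v) :=
        ⟨hTr, fun T' hT' => by have := hS.2 T' hT'; omega⟩
      have hone := Finset.card_eq_one.1
        (show (T.filter fun s => ¬ R.root s = v).card = 1 by omega)
      obtain ⟨w', hw'⟩ := hone
      have hroots : ∀ s ∈ T, R.root s = v ∨ R.root s = R.root w := by
        intro s hs
        by_cases hsv : R.root s = v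
        · exact Or.inl hsv
        · have hsm : s ∈ T.filter fun s => ¬ R.root s = v := Finset.mem_filter.2 ⟨hs, hsv⟩
          rw [hw', Finset.mem_singleton] at hsm hwm
          rw [hsm, ← hwm]
          exact Or.inr rfl
      have hbads : ∀ c, c = v ∨ c = R.root w → IsBad G c →
          ∃ x, x ∉ cycleVerts G ∧ R.par x = c ∧ ∀ s ∈ T, s ∉ R.desc x := by
        intro c _ hbad
        obtain rfl := hbranch c hbad.1 (not_noBranching_of_isBad R hbad)
        obtain ⟨x, hx, hxc, hfree⟩ := hmin.exists_free hbad
        refine ⟨x, hx, hxc, fun s hs hsx => hfree s (Finset.mem_filter.2 ⟨hs, ?_⟩) hsx⟩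
        rw [R.root_eq_of_mem_desc hsx, ← R.root_par, hxc, R.root_cycle hbad.1]
      obtain ⟨a, j, ha, ha0, h⟩ := exists_edgeOddOrEven hT hvC (R.root_mem w) (Ne.symm hwv)
        hroots hbads
      exact hno ⟨a, j, ha, Or.inl ha0, h⟩

theorem edim_of_two_active (hS : R.IsMinResolving S) (hleaf : ∀ s ∈ S, G.degree s = 1)
    (hact : 2 ≤ (activeVerts G S).ncard) {a : ℕ → V} (hn : IsNormalLabelling G a S) :
    (((∃ x ∈ activeVerts G S, ∃ y ∈ activeVerts G S, ∃ z ∈ activeVerts G S,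
        IsGeodesicTriple G x y z) ∨ EdgeOddOrEven G a (maxActiveIndex G a S)) →
      edim G = S.card) ∧
    ((¬ ((∃ x ∈ activeVerts G S, ∃ y ∈ activeVerts G S, ∃ z ∈ activeVerts G S,
        IsGeodesicTriple G x y z) ∨ EdgeOddOrEven G a (maxActiveIndex G a S))) →
      edim G = S.card + 1) := by
  classical
  have h3 := R.three_le
  obtain ⟨ha, h0, hmin⟩ := id hn
  obtain ⟨hjl, hja⟩ := maxActiveIndex_mem ⟨0, by omega, h0⟩
  have hle := fun i => le_maxActiveIndex (G := G) (a := a) (S := S) (i := i)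
  have hlow : ∀ T, IsEdgeMetricGenerator G T → S.card ≤ T.card :=
    fun T hT => hS.2 T (R.resolves_of_isEdgeMetricGenerator hT)
  have hpos : ∀ s, R.root s ∈ activeVerts G S → R.pos a s ≤ maxActiveIndex G a S := by
    intro s hs
    refine hle _ (R.pos_lt ha s) ?_
    rwa [R.apply_pos ha]
  constructor
  · rintro (⟨x, hx, y, hy, z, hz, h⟩ | h)
    · exact edim_eq (hS.1.isEdgeMetricGenerator_of_triple hx hy hz h) le_rfl hlow
    · refine edim_eq (hS.1.isEdgeMetricGenerator_of_edgeOddOrEven ha h h0 hja ?_ ?_) le_rfl hlow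
      · exact fun s hs => hpos s (R.mem_activeVerts_iff.2 ⟨s, hs, rfl⟩)
      · exact fun s hs hsC => absurd hsC (notMem_cycle_of_leaf R hleaf hs)
  · intro hno
    obtain ⟨u, hu, w, hw, huw⟩ := (Set.one_lt_ncard (Set.toFinite _)).1 hact
    obtain ⟨b, j, hb, rfl, rfl, hj1, hj2⟩ := exists_labelling_pair R hu.1 hw.1 huw
    refine edim_eq (exists_geodesic_extension R hb hS.1 hj1 hj2 hu hw)
      (Finset.card_insert_le _ _) fun T hT => ?_
    by_contra! hlt
    have hcard : T.card = S.card := by have := hlow T hT; omega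
    -- A generator of size |S| is itself minimum resolving, so it has the active vertices of `S` and
    -- misses a thread at every bad vertex.
    have hTmin : R.IsMinResolving T :=
      ⟨R.resolves_of_isEdgeMetricGenerator hT, fun T' hT' => hcard ▸ hS.2 T' hT'⟩
    have hactT : ∀ s ∈ T, R.root s ∈ activeVerts G S := fun s hs =>
      (hS.mem_active_iff (R.root_mem s)).2
        (hTmin.not_noBranching (R.mem_activeVerts_iff.2 ⟨s, hs, rfl⟩))
    have htri := fun h => hno (Or.inl h)
    have hlt2 : 2 * maxActiveIndex G a S < cycleLength G := by
      refine hn.maxActiveIndex_lt R ?_ htri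
      obtain ⟨s, hs, hs0, hsl⟩ := exists_pos_of_isEdgeMetricGenerator (R := R) ha hT
      exact ⟨R.pos a s, R.pos_lt ha s, (R.apply_pos ha s).symm ▸ hactT s hs, hs0, hsl⟩
    have hj : 1 ≤ maxActiveIndex G a S := by
      obtain ⟨s, hs, hs0, -⟩ := exists_pos_of_isEdgeMetricGenerator (R := R) ha hT
      have := hpos s (hactT s hs)
      omega
    refine hno (Or.inr (edgeOddOrEven_of_isEdgeMetricGenerator hT ha ⟨hj, by omega⟩
      (fun s hs => hpos s (hactT s hs)) (fun k _ hnb hk => hTmin.not_noBranching hk hnb)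
      fun c _ hbad => hTmin.exists_free hbad))

end Rooting

end Unicyclic

theorem corollary2 {V : Type*} [Fintype V] (G : SimpleGraph V) [DecidableRel G.Adj]
    (hG : Unicyclic.IsUnicyclic G) (S : Finset V) (hS : S ∈ Unicyclic.minLeafBranchSets G) :
    -- (1) no active vertex
    (Unicyclic.activeVerts G S = ∅ →
      ((∃ (a : ℕ → V) (j : ℕ), Unicyclic.IsCycleLabelling G a ∧ Unicyclic.EdgeOddOrEven G a j) →
        Unicyclic.edim G = 2) ∧
      ((¬ ∃ (a : ℕ → V) (j : ℕ),
          Unicyclic.IsCycleLabelling G a ∧ Unicyclic.EdgeOddOrEven G a j) →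
        Unicyclic.edim G = 3)) ∧
    -- (2) exactly one active vertex `v`
    (∀ v : V, Unicyclic.activeVerts G S = {v} →
      ((∃ (a : ℕ → V) (j : ℕ), Unicyclic.IsCycleLabelling G a ∧ (a 0 = v ∨ a j = v) ∧
          Unicyclic.EdgeOddOrEven G a j) →
        Unicyclic.edim G = Unicyclic.minBranch G + 1) ∧
      ((¬ ∃ (a : ℕ → V) (j : ℕ), Unicyclic.IsCycleLabelling G a ∧ (a 0 = v ∨ a j = v) ∧
          Unicyclic.EdgeOddOrEven G a j) →
        Unicyclic.edim G = Unicyclic.minBranch G + 2)) ∧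
    -- (3) at least two active vertices, for every normal labelling `a`
    (2 ≤ (Unicyclic.activeVerts G S).ncard →
      ∀ a : ℕ → V, Unicyclic.IsNormalLabelling G a S →
      (((∃ x ∈ Unicyclic.activeVerts G S, ∃ y ∈ Unicyclic.activeVerts G S,
            ∃ z ∈ Unicyclic.activeVerts G S, Unicyclic.IsGeodesicTriple G x y z) ∨
          Unicyclic.EdgeOddOrEven G a (Unicyclic.maxActiveIndex G a S)) →
        Unicyclic.edim G = Unicyclic.minBranch G) ∧
      ((¬ ((∃ x ∈ Unicyclic.activeVerts G S, ∃ y ∈ Unicyclic.activeVerts G S,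
            ∃ z ∈ Unicyclic.activeVerts G S, Unicyclic.IsGeodesicTriple G x y z) ∨
          Unicyclic.EdgeOddOrEven G a (Unicyclic.maxActiveIndex G a S))) →
        Unicyclic.edim G = Unicyclic.minBranch G + 1)) := by
  obtain ⟨R⟩ := Unicyclic.exists_rooting hG
  obtain ⟨hbr, hcard, hleaf⟩ := hS
  have hmin : R.IsMinResolving S := R.isMinResolving_of_card ((R.resolves_iff S).2 hbr) hcard
  rw [← hcard]
  exact ⟨fun h => Unicyclic.Rooting.edim_of_no_active hmin hleaf h,
    fun v h => Unicyclic.Rooting.edim_of_one_active hmin hleaf h,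
    fun h a hn => Unicyclic.Rooting.edim_of_two_active hmin hleaf h hn⟩
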